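/- Let $F$ be a field of characteristic $p>0$, let $(L,[p])$ be a finite-dimensional restricted Lie algebra over $F$ with bracket $[\cdot,\cdot]$, let $I$ be an ideal of $L$, and let $\lambda\in I^*$ be a linear form with $\lambda([I,I])=0$. Put $$L^\lambda=\{x\in L \mid \lambda([x,y])=0 \text{ for all } y\in I\},$$ which is a $p$-subalgebra of $L$. Let $S\in L^*$, and let $M$ be a finite-dimensional $L^\lambda$-module with character $S|_{L^\lambda}$, that is, $x^p\cdot m-x^{[p]}\cdot m=S(x)^p m$ for all $x\in L^\lambda$, $m\in M$, where $x^p\cdot m$ means that $x$ acts $p$ times. Suppose that $x\cdot m=\lambda(x)m$ for all $x\in I\cap L^\lambda=I$ and $m\in M$. For a $p$-subalgebra $H$ of $L$, let $u(H,S|_H)$ be the quotient of the universal enveloping algebra $U(H)$ by the two-sided ideal generated by the elements $x^p-x^{[p]}-S(x)^p1$, $x\in H$. For every $L^\lambda$-submodule $N\subseteq M$ (including $N=M$) let $$\operatorname{Ind}_{L^\lambda}^L(N,S)=u(L,S)\otimes_{u(L^\lambda,S|_{L^\lambda})}N ,$$ regarded as an $L$-module through left multiplication. Let $W$ be an $L$-submodule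 of $\operatorname{Ind}_{L^\lambda}^L(M,S)$. Then there is an $L^\lambda$-submodule $N$ of $M$ such that $$W\cap(1\otimes M)=1\otimes N$$ and $W\cong\operatorname{Ind}_{L^\lambda}^L(N,S)$ as $L$-modules; more precisely, there is an isomorphism of $L$-modules $\operatorname{Ind}_{L^\lambda}^L(N,S)\to W$ that sends $a\otimes n$ to $a\otimes n$ for all $a\in u(L,S)$ and $n\in N$. Moreover, $W$ is determined by its bottom layer $W\cap(1\otimes M)$: if $W'$ is an $L$-submodule of $\operatorname{Ind}_{L^\lambda}^L(M,S)$ with $W'\cap(1\otimes M)=W\cap(1\otimes M)$, then $W'=W$. -/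

import Mathlib

open scoped TensorProduct Polynomial

attribute [local instance 100] LieRing.ofAssociativeRing

noncomputable section

namespace ModularLie

universe u v w

section PMappings

variable {F : Type u} {L : Type v} [Field F] [LieRing L] [LieAlgebra F L]

/-- The element `s_i(a, b)` of `L`: in the Lie algebra `F[X] ⊗ L` (with the `F[X]`-bilinear bracket)
one has `(ad (X ⊗ a + 1 ⊗ b)) ^ (p - 1) (1 ⊗ a) = ∑ i = 1, …, p - 1, i X ^ (i - 1) ⊗ s_i(a, b)`, so
`s_i(a, b)` is `i⁻¹` times the coefficient of `X ^ (i - 1)`. It is used for `1 ≤ i ≤ p - 1` and over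
fields of characteristic `p` only, where `i` is invertible. -/
def jacobsonTerm (p : ℕ) (i : ℕ) (a b : L) : L :=
  (i : F)⁻¹ • TensorProduct.lid F L
    (LinearMap.rTensor L (Polynomial.lcoeff F (i - 1))
      (((LieAlgebra.ad F[X] (F[X] ⊗[F] L)
          ((Polynomial.X : F[X]) ⊗ₜ[F] a + (1 : F[X]) ⊗ₜ[F] b)) ^ (p - 1))
        ((1 : F[X]) ⊗ₜ[F] a)))

variable (F) in
/-- `q : L → L` is a `p`-mapping `x ↦ x ^ [p]`, i.e. `(L, q)` is a restricted Lie algebra over the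
field `F` of characteristic `p`. -/
structure IsPMapping (p : ℕ) (q : L → L) : Prop where
  ad_apply (a : L) : LieAlgebra.ad F L (q a) = LieAlgebra.ad F L a ^ p
  smul (c : F) (a : L) : q (c • a) = c ^ p • q a
  add (a b : L) : q (a + b) = q a + q b + ∑ i ∈ Finset.Icc 1 (p - 1), jacobsonTerm (F := F) p i a b

/-- A subalgebra `H` is a `p`-subalgebra if `x ^ [p] ∈ H` for all `x ∈ H`. -/
def IsPSubalgebra (q : L → L) (H : LieSubalgebra F L) : Prop :=
  ∀ x ∈ H, q x ∈ H

/-- The restriction of the `p`-mapping to a `p`-subalgebra. -/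
def restrictPMapping (q : L → L) (H : LieSubalgebra F L) (hH : IsPSubalgebra q H) : H → H :=
  fun x => ⟨q x, hH x x.2⟩

/-- The restriction of a linear form to a subalgebra. -/
def restrictForm (S : Module.Dual F L) (H : LieSubalgebra F L) : Module.Dual F H :=
  S ∘ₗ (H.incl : H →ₗ[F] L)

/-- The `L`-module `V` has character `S`: `ρ(x) ^ p - ρ(x ^ [p]) = S(x) ^ p • id` for all `x`. -/
def HasCharacter (p : ℕ) (q : L → L) (S : Module.Dual F L) (V : Type w) [AddCommGroup V]
    [Module F V] [LieRingModule L V] [LieModule F L V] : Prop :=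
  ∀ x : L, LieModule.toEnd F L V x ^ p - LieModule.toEnd F L V (q x)
    = S x ^ p • (1 : Module.End F V)

theorem HasCharacter.lieSubmodule {p : ℕ} {q : L → L} {S : Module.Dual F L} {V : Type w}
    [AddCommGroup V] [Module F V] [LieRingModule L V] [LieModule F L V]
    (h : HasCharacter p q S V) (N : LieSubmodule F L V) : HasCharacter p q S N := by
  intro x
  have key : ∀ (k : ℕ) (n : N), (((LieModule.toEnd F L N x ^ k) n : N) : V)
      = (LieModule.toEnd F L V x ^ k) (n : V) := by
    intro k
    induction k with
    | zero => intro n; simp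
    | succ k ih => intro n; rw [pow_succ, pow_succ, Module.End.mul_apply, Module.End.mul_apply, ih]; simp
  ext n
  have := congrArg (fun g => g (n : V)) (h x)
  simpa [key] using this

end PMappings

section Reduced

variable (F : Type u) {L : Type v} [Field F] [LieRing L] [LieAlgebra F L]

/-- The defining relations `x ^ p = x ^ [p] + S(x) ^ p 1` of `u(L, S)` in `U(L)`. -/
inductive reducedRel (p : ℕ) (q : L → L) (S : Module.Dual F L) :
    UniversalEnvelopingAlgebra F L → UniversalEnvelopingAlgebra F L → Prop
  | intro (x : L) : reducedRel p q S (UniversalEnvelopingAlgebra.ι F x ^ p)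
      (UniversalEnvelopingAlgebra.ι F (q x)
        + algebraMap F (UniversalEnvelopingAlgebra F L) (S x ^ p))

variable {F}

/-- The `S`-reduced universal enveloping algebra `u(L, S)`: the quotient of `U(L)` by the two-sided
ideal generated by the elements `x ^ p - x ^ [p] - S(x) ^ p 1`. -/
abbrev ReducedEnveloping (p : ℕ) (q : L → L) (S : Module.Dual F L) : Type (max u v) :=
  RingQuot (reducedRel F p q S)

namespace ReducedEnveloping

/-- The canonical map `L → u(L, S)`. -/
def ι (p : ℕ) (q : L → L) (S : Module.Dual F L) : L →ₗ⁅F⁆ ReducedEnveloping p q S :=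
  (RingQuot.mkAlgHom F (reducedRel F p q S) : _ →ₗ⁅F⁆ _).comp (UniversalEnvelopingAlgebra.ι F)

theorem ι_pow (p : ℕ) (q : L → L) (S : Module.Dual F L) (x : L) :
    ι p q S x ^ p = ι p q S (q x) + algebraMap F _ (S x ^ p) := by
  have := RingQuot.mkAlgHom_rel F (reducedRel.intro (p := p) (q := q) (S := S) x)
  rw [map_pow, map_add, AlgHom.commutes] at this
  exact this

/-- The universal property of `u(L, S)`. -/
def lift {p : ℕ} {q : L → L} {S : Module.Dual F L} {A : Type w} [Ring A] [Algebra F A]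
    (f : L →ₗ⁅F⁆ A) (hf : ∀ x, f x ^ p = f (q x) + algebraMap F A (S x ^ p)) :
    ReducedEnveloping p q S →ₐ[F] A :=
  RingQuot.liftAlgHom F ⟨UniversalEnvelopingAlgebra.lift F f, by
    rintro _ _ ⟨x⟩
    rw [map_pow, map_add, AlgHom.commutes, UniversalEnvelopingAlgebra.lift_ι_apply,
      UniversalEnvelopingAlgebra.lift_ι_apply]
    exact hf x⟩

theorem lift_ι {p : ℕ} {q : L → L} {S : Module.Dual F L} {A : Type w} [Ring A] [Algebra F A]
    (f : L →ₗ⁅F⁆ A) (hf : ∀ x, f x ^ p = f (q x) + algebraMap F A (S x ^ p)) (x : L) :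
    lift f hf (ι p q S x) = f x := by
  have h : lift f hf (RingQuot.mkAlgHom F (reducedRel F p q S) (UniversalEnvelopingAlgebra.ι F x))
      = UniversalEnvelopingAlgebra.lift F f (UniversalEnvelopingAlgebra.ι F x) :=
    RingQuot.liftAlgHom_mkAlgHom_apply F _ _ _
  rw [UniversalEnvelopingAlgebra.lift_ι_apply] at h
  exact h

/-- The canonical homomorphism `u(H, S|_H) → u(L, S)` for a `p`-subalgebra `H` of `L`. -/
def incl (p : ℕ) (q : L → L) (S : Module.Dual F L) (H : LieSubalgebra F L)
    (hH : IsPSubalgebra q H) :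
    ReducedEnveloping p (restrictPMapping q H hH) (restrictForm S H)
      →ₐ[F] ReducedEnveloping p q S :=
  lift ((ι p q S).comp H.incl) fun x => by
    simp only [LieHom.comp_apply]
    exact ι_pow p q S (x : L)

theorem incl_ι (p : ℕ) (q : L → L) (S : Module.Dual F L) (H : LieSubalgebra F L)
    (hH : IsPSubalgebra q H) (x : H) : incl p q S H hH (ι p _ _ x) = ι p q S (x : L) :=
  lift_ι _ _ x

/-- The action of `u(L, S)` on an `L`-module with character `S`. -/
def toEnd {p : ℕ} {q : L → L} {S : Module.Dual F L} (V : Type w) [AddCommGroup V]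
    [Module F V] [LieRingModule L V] [LieModule F L V] (hV : HasCharacter p q S V) :
    ReducedEnveloping p q S →ₐ[F] Module.End F V :=
  lift (LieModule.toEnd F L V) fun x => by
    rw [Algebra.algebraMap_eq_smul_one, ← hV x, add_sub_cancel]

theorem toEnd_ι {p : ℕ} {q : L → L} {S : Module.Dual F L} (V : Type w) [AddCommGroup V]
    [Module F V] [LieRingModule L V] [LieModule F L V] (hV : HasCharacter p q S V) (x : L) (v : V) :
    toEnd V hV (ι p q S x) v = ⁅x, v⁆ := by
  rw [toEnd, lift_ι, LieModule.toEnd_apply_apply]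

end ReducedEnveloping

end Reduced

section BalancedTensor

variable {F : Type u} [Field F] {A : Type v} [Ring A] [Algebra F A] {B : Type w} [Ring B]
  [Algebra F B] {M : Type*} [AddCommGroup M] [Module F M]

/-- For a homomorphism `f : A → B` of associative algebras and a left `A`-module `M` given by
`ρ : A → End M`, the submodule of `B ⊗_F M` by which one divides to get `B ⊗_A M`; it is spanned by
the elements `b f(a) ⊗ m - b ⊗ a m`. -/
def balancedRel (f : A →ₐ[F] B) (ρ : A →ₐ[F] Module.End F M) : Submodule B (B ⊗[F] M) :=
  Submodule.span B {t | ∃ (b : B) (a : A) (m : M), t = (b * f a) ⊗ₜ[F] m - b ⊗ₜ[F] (ρ a m)}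

end BalancedTensor

section Induced

variable {F : Type u} {L : Type v} [Field F] [LieRing L] [LieAlgebra F L]
variable (p : ℕ) (q : L → L) (S : Module.Dual F L) (H : LieSubalgebra F L)
  (hH : IsPSubalgebra q H) (M : Type w) [AddCommGroup M] [Module F M] [LieRingModule H M]
  [LieModule F H M] (hM : HasCharacter p (restrictPMapping q H hH) (restrictForm S H) M)

/-- The induced module `Ind_H^L(M, S) = u(L, S) ⊗_{u(H, S|_H)} M`. -/
def Ind : Type (max u v w) :=
  (ReducedEnveloping p q S ⊗[F] M) ⧸
    balancedRel (ReducedEnveloping.incl p q S H hH) (ReducedEnveloping.toEnd M hM)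

namespace Ind

instance : AddCommGroup (Ind p q S H hH M hM) :=
  inferInstanceAs (AddCommGroup (_ ⧸ balancedRel _ _))

instance : Module (ReducedEnveloping p q S) (Ind p q S H hH M hM) :=
  inferInstanceAs (Module _ (_ ⧸ balancedRel _ _))

instance : Module F (Ind p q S H hH M hM) :=
  inferInstanceAs (Module F (_ ⧸ balancedRel _ _))

instance : IsScalarTower F (ReducedEnveloping p q S) (Ind p q S H hH M hM) :=
  inferInstanceAs (IsScalarTower F _ (_ ⧸ balancedRel _ _))

/-- The element `a ⊗ m` of `Ind_H^L(M, S)`. -/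
def tmul (a : ReducedEnveloping p q S) (m : M) : Ind p q S H hH M hM :=
  Submodule.Quotient.mk (a ⊗ₜ[F] m)

/-- `L` acts on `Ind_H^L(M, S)` through `L → u(L, S)`. -/
instance : LieRingModule L (Ind p q S H hH M hM) where
  bracket x t := ReducedEnveloping.ι p q S x • t
  add_lie x y t := by
    change ReducedEnveloping.ι p q S (x + y) • t = _ • t + _ • t
    rw [map_add, add_smul]
  lie_add x s t := smul_add (ReducedEnveloping.ι p q S x) s t
  leibniz_lie x y t := by
    change _ • _ • t = ReducedEnveloping.ι p q S ⁅x, y⁆ • t + _ • _ • t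
    rw [LieHom.map_lie, LieRing.of_associative_ring_bracket, sub_smul, mul_smul, mul_smul,
      sub_add_cancel]

theorem lie_def (x : L) (t : Ind p q S H hH M hM) : ⁅x, t⁆ = ReducedEnveloping.ι p q S x • t := rfl

theorem smul_tmul (a b : ReducedEnveloping p q S) (m : M) :
    a • tmul p q S H hH M hM b m = tmul p q S H hH M hM (a * b) m := rfl

instance : LieModule F L (Ind p q S H hH M hM) where
  smul_lie c x t := by
    rw [lie_def, lie_def, map_smul, smul_assoc]
  lie_smul c x t := by
    rw [lie_def, lie_def, ← algebraMap_smul (ReducedEnveloping p q S) c t,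
      ← algebraMap_smul (ReducedEnveloping p q S) c (_ • t), ← mul_smul, ← mul_smul,
      Algebra.commutes]

end Ind

end Induced

section Stabilizer

variable {F : Type u} {L : Type v} [Field F] [LieRing L] [LieAlgebra F L]

/-- The subalgebra `L^λ = {x ∈ L | λ([x, y]) = 0 for all y ∈ I}`, for a linear form `lam` on an
ideal `I` of `L`. -/
def lambdaSubalgebra (I : LieIdeal F L) (lam : Module.Dual F I) : LieSubalgebra F L where
  carrier := {x | ∀ y : I, lam ⁅x, y⁆ = 0}
  zero_mem' y := by simp
  add_mem' {a b} ha hb y := by rw [add_lie, map_add, ha y, hb y, add_zero]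
  smul_mem' c a ha y := by rw [smul_lie, map_smul, ha y, smul_zero]
  lie_mem' {a b} ha hb y := by rw [lie_lie, map_sub, ha _, hb _, sub_zero]

theorem isPSubalgebra_lambdaSubalgebra {p : ℕ} [hp : Fact p.Prime] {q : L → L} (hq : IsPMapping F p q)
    (I : LieIdeal F L) (lam : Module.Dual F I) : IsPSubalgebra q (lambdaSubalgebra I lam) := by
  intro x hx y
  obtain ⟨k, rfl⟩ := Nat.exists_eq_succ_of_ne_zero hp.out.ne_zero
  have key : ∀ (n : ℕ) (y : I), ((LieModule.toEnd F L I x ^ n) y : L)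
      = (LieAlgebra.ad F L x ^ n) (y : L) := by
    intro n
    induction n with
    | zero => intro y; simp
    | succ n ih =>
      intro y
      rw [pow_succ, pow_succ, Module.End.mul_apply, Module.End.mul_apply, ih]
      simp
  have h : ⁅q x, y⁆ = ⁅x, (LieModule.toEnd F L I x ^ k) y⁆ := by
    apply Subtype.ext
    have h1 : ((⁅q x, y⁆ : I) : L) = (LieAlgebra.ad F L (q x)) (y : L) := by simp
    have h2 : ((⁅x, (LieModule.toEnd F L I x ^ k) y⁆ : I) : L)
        = ⁅x, ((LieModule.toEnd F L I x ^ k) y : L)⁆ := rfl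
    rw [h1, h2, hq.ad_apply, key, Nat.succ_eq_add_one, pow_succ', Module.End.mul_apply,
      LieAlgebra.ad_apply]
  rw [h]
  exact hx _

/-- The induced module `Ind_{L^λ}^L(M, S)`. -/
abbrev IndLambda (p : ℕ) [Fact p.Prime] {q : L → L} (hq : IsPMapping F p q) (S : Module.Dual F L)
    (I : LieIdeal F L) (lam : Module.Dual F I) (M : Type w) [AddCommGroup M] [Module F M]
    [LieRingModule (lambdaSubalgebra I lam) M] [LieModule F (lambdaSubalgebra I lam) M]
    (hM : HasCharacter p
      (restrictPMapping q (lambdaSubalgebra I lam) (isPSubalgebra_lambdaSubalgebra hq I lam))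
      (restrictForm S (lambdaSubalgebra I lam)) M) : Type (max u v w) :=
  Ind p q S (lambdaSubalgebra I lam) (isPSubalgebra_lambdaSubalgebra hq I lam) M hM

/-- The element `a ⊗ m` of `Ind_{L^λ}^L(M, S)`. -/
abbrev IndLambda.tmul {p : ℕ} [Fact p.Prime] {q : L → L} {hq : IsPMapping F p q}
    {S : Module.Dual F L} {I : LieIdeal F L} {lam : Module.Dual F I} {M : Type w}
    [AddCommGroup M] [Module F M]
    [LieRingModule (lambdaSubalgebra I lam) M] [LieModule F (lambdaSubalgebra I lam) M]
    {hM : HasCharacter p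
      (restrictPMapping q (lambdaSubalgebra I lam) (isPSubalgebra_lambdaSubalgebra hq I lam))
      (restrictForm S (lambdaSubalgebra I lam)) M}
    (a : ReducedEnveloping p q S) (m : M) : IndLambda p hq S I lam M hM :=
  Ind.tmul p q S (lambdaSubalgebra I lam) (isPSubalgebra_lambdaSubalgebra hq I lam) M hM a m

end Stabilizer

end ModularLie

end

open ModularLie

/-! Everything follows from a comparison principle (`IndLambda.le_of_bottom_le`): a submodule `W` of
an induced module is contained in `W'` as soon as the bottom layer of `W` is. Filter `Ind M` by the
length of words `x₁ ⋯ xᵣ ⊗ m`. Since `I` is an ideal acting on the bottom layer through `λ`, each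
operator `y - λ(y)` with `y ∈ I` shortens words by one letter. It behaves like a derivation: up to
shorter words, it replaces a letter `x` by the scalar `-λ([x, y])`, one letter at a time.

Choose a basis `eᵢ` of a complement of `L^λ` and elements `yᵢ ∈ I` dual to it for `-λ([·, ·])`. Then
`eᵢ (yᵢ - λ(yᵢ))` is an Euler operator `xᵢ ∂/∂xᵢ`: modulo shorter words it multiplies a word in the
`eⱼ` by the number of its letters `eᵢ`. By the `p`-character, words in which every letter occurs
fewer than `p` times suffice, so Fermat's little theorem makes `∏ᵢ (1 - (eᵢ (yᵢ - λ(yᵢ)))^(p - 1))`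
strictly shorten all words of positive length. If every `y - λ(y)` sends `w` into a submodule `W₀`,
the same product fixes `w` modulo `W₀`. Descending on the length gives `w ∈ 1 ⊗ M + W₀`
(`mem_sup_of_shifted_mem`). With `W₀ = W ∩ W'` and induction on the length, the comparison principle
follows.

Given `W`, let `N` consist of the `m` with `1 ⊗ m ∈ W`. The comparison principle in `Ind M` shows
that the natural map `Ind N → Ind M` has image `W`. In `Ind N`, it shows that this map is injective,
because the bottom layer of its kernel vanishes. It also yields uniqueness.

The vanishing on the bottom layer requires `m ↦ 1 ⊗ m` to be injective. This is the only place where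
the independence half of the Poincaré–Birkhoff–Witt theorem for `u(L, S)` enters: it makes `u(L, S)`
free over `u(L^λ, S)`, with `1` in a basis. It is proved from scratch, by letting `L` act on
polynomials, showing that the central elements `x^p - x^[p] - S(x)^p` act like `Xᵢ^p` in leading
degree, and dividing out their images. -/

namespace ModularLie

/-! ### Degree filtration of a polynomial ring. -/

section PolynomialFiltration

open MvPolynomial

variable {ι F : Type*} [Field F]

variable (ι F) in
/-- The polynomials all of whose monomials have degree less than `d`. -/
noncomputable def polyFilt (d : ℕ) : Submodule F (MvPolynomial ι F) :=
  Submodule.span F ((fun s => monomial s (1 : F)) '' {s : ι →₀ ℕ | s.degree < d})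

theorem monomial_mem_polyFilt {s : ι →₀ ℕ} {d : ℕ} (h : s.degree < d) :
    monomial s (1 : F) ∈ polyFilt ι F d :=
  Submodule.subset_span ⟨s, h, rfl⟩

theorem polyFilt_mono {d e : ℕ} (h : d ≤ e) : polyFilt ι F d ≤ polyFilt ι F e :=
  Submodule.span_mono (Set.image_mono fun _ hs => lt_of_lt_of_le hs h)

theorem polyFilt_zero : polyFilt ι F 0 = ⊥ := by
  simp [polyFilt]

theorem polyFilt_le {d : ℕ} {K : Submodule F (MvPolynomial ι F)}
    (h : ∀ s : ι →₀ ℕ, s.degree < d → monomial s (1 : F) ∈ K) : polyFilt ι F d ≤ K := by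
  refine Submodule.span_le.2 ?_
  rintro _ ⟨s, hs, rfl⟩
  exact h s hs

theorem map_mem_of_polyFilt {d : ℕ} {V : Type*} [AddCommGroup V] [Module F V]
    {T : MvPolynomial ι F →ₗ[F] V} {K : Submodule F V}
    (h : ∀ s : ι →₀ ℕ, s.degree < d → T (monomial s (1 : F)) ∈ K) {v : MvPolynomial ι F}
    (hv : v ∈ polyFilt ι F d) : T v ∈ K :=
  polyFilt_le (K := K.comap T) h hv

theorem exists_mem_polyFilt (v : MvPolynomial ι F) : ∃ d, v ∈ polyFilt ι F d := by
  induction v using MvPolynomial.induction_on' with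
  | monomial s a =>
    refine ⟨s.degree + 1, ?_⟩
    have : monomial s a = a • monomial s (1 : F) := by simp [smul_monomial]
    rw [this]
    exact Submodule.smul_mem _ _ (monomial_mem_polyFilt (Nat.lt_succ_self _))
  | add f g hf hg =>
    obtain ⟨d, hd⟩ := hf
    obtain ⟨e, he⟩ := hg
    exact ⟨max d e, Submodule.add_mem _ (polyFilt_mono (le_max_left _ _) hd)
      (polyFilt_mono (le_max_right _ _) he)⟩

theorem constr_monomial {V : Type*} [AddCommGroup V] [Module F V] (f : (ι →₀ ℕ) → V)
    (s : ι →₀ ℕ) : (basisMonomials ι F).constr F f (monomial s 1) = f s :=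
  (basisMonomials ι F).constr_basis F f s

theorem X_mul_monomial_one (i : ι) (s : ι →₀ ℕ) :
    X i * monomial s (1 : F) = monomial (Finsupp.single i 1 + s) 1 := by
  rw [X, monomial_mul, one_mul]

theorem X_mul_mem_polyFilt (i : ι) {d : ℕ} {v : MvPolynomial ι F} (hv : v ∈ polyFilt ι F d) :
    X i * v ∈ polyFilt ι F (d + 1) := by
  refine map_mem_of_polyFilt (T := LinearMap.mulLeft F (X i : MvPolynomial ι F)) (fun s hs => ?_) hv
  rw [LinearMap.mulLeft_apply, X_mul_monomial_one]
  refine monomial_mem_polyFilt ?_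
  rw [map_add, Finsupp.degree_single]
  omega

end PolynomialFiltration

/-! ### The action of a Lie algebra on polynomials in a basis. -/

section PBW

open MvPolynomial

variable {ι F L : Type*} [Field F] [LieRing L] [LieAlgebra F L]

section LinearForm

variable (b : Module.Basis ι F L)

/-- The linear form on `L` as an element of the symmetric algebra. -/
noncomputable def toLinearForm : L →ₗ[F] MvPolynomial ι F := b.constr F X

theorem toLinearForm_basis (i : ι) : toLinearForm b (b i) = X i := by
  rw [toLinearForm, Module.Basis.constr_basis]

theorem linear_induction_basis {V : Type*} [AddCommGroup V] [Module F V] {T : L →ₗ[F] V}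
    {K : Submodule F V} (h : ∀ i, T (b i) ∈ K) (x : L) : T x ∈ K := by
  have : ⊤ ≤ K.comap T := by
    rw [← b.span_eq, Submodule.span_le]
    rintro _ ⟨i, rfl⟩
    exact h i
  exact this (Submodule.mem_top (x := x))

theorem toLinearForm_mul_mem (x : L) {d : ℕ} {v : MvPolynomial ι F} (hv : v ∈ polyFilt ι F d) :
    toLinearForm b x * v ∈ polyFilt ι F (d + 1) :=
  linear_induction_basis b (T := (LinearMap.mulRight F v) ∘ₗ toLinearForm b)
    (fun i => by simpa [toLinearForm_basis] using X_mul_mem_polyFilt i hv) x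

end LinearForm

variable [LinearOrder ι]

/-- Approximations to the action of `L` on the polynomial ring in a basis of `L`. The `N`-th one is
correct in degrees less than `N`. -/
noncomputable def pbwAux (b : Module.Basis ι F L) : ℕ → L →ₗ[F] Module.End F (MvPolynomial ι F)
  | 0 => 0
  | N + 1 => b.constr F fun i => (basisMonomials ι F).constr F fun s =>
      if h : ∀ j ∈ s.support, i ≤ j then X i * monomial s 1
      else
        let j := s.support.min' (by
          by_contra h'
          rw [Finset.not_nonempty_iff_eq_empty] at h'
          exact h (by simp [h']))
        let s' := s - Finsupp.single j 1
        X i * monomial s 1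
          + pbwAux b N (b j) (pbwAux b N (b i) (monomial s' 1) - X i * monomial s' 1)
          + pbwAux b N ⁅b i, b j⁆ (monomial s' 1)

variable (b : Module.Basis ι F L)

theorem pbwAux_succ_of_le (N : ℕ) {i : ι} {s : ι →₀ ℕ} (h : ∀ j ∈ s.support, i ≤ j) :
    pbwAux b (N + 1) (b i) (monomial s 1) = X i * monomial s 1 := by
  rw [pbwAux, Module.Basis.constr_basis, constr_monomial, dif_pos h]

/-- The recursion is forced by `xᵢ xⱼ t = xⱼ xᵢ t + [xᵢ, xⱼ] t`, where `xⱼ t = Xⱼ t`. Splitting `xᵢ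
t` into `Xᵢ t` and a remainder, `xⱼ` acts on `Xᵢ t` by multiplication, as `j` is least. The
remainder has lower degree, so an earlier approximation suffices for it. -/
theorem pbwAux_succ_of_lt (N : ℕ) {i j : ι} {t : ι →₀ ℕ} (hj : ∀ k ∈ t.support, j ≤ k)
    (hij : j < i) :
    pbwAux b (N + 1) (b i) (monomial (Finsupp.single j 1 + t) 1)
      = X i * monomial (Finsupp.single j 1 + t) 1
          + pbwAux b N (b j) (pbwAux b N (b i) (monomial t 1) - X i * monomial t 1)
          + pbwAux b N ⁅b i, b j⁆ (monomial t 1) := by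
  have hjs : j ∈ (Finsupp.single j 1 + t).support := by simp
  have hs : ∀ k ∈ (Finsupp.single j 1 + t).support, j ≤ k := by
    intro k hk
    rcases Finset.mem_union.1 (Finsupp.support_add hk) with h | h
    · exact (Finset.mem_singleton.1 (Finsupp.support_single_subset h)).ge
    · exact hj k h
  have hmin : ∀ h, (Finsupp.single j 1 + t).support.min' h = j := fun h =>
    le_antisymm (Finset.min'_le _ _ hjs) (Finset.le_min' _ _ _ hs)
  rw [pbwAux, Module.Basis.constr_basis, constr_monomial,
    dif_neg (fun h => absurd (h j hjs) (not_le.2 hij))]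
  simp only [hmin, add_tsub_cancel_left]

/-- A monomial is either `≥ i`, or it has a least variable `j < i`. -/
theorem exists_min_variable (i : ι) (s : ι →₀ ℕ) : (∀ j ∈ s.support, i ≤ j) ∨
    ∃ (j : ι) (t : ι →₀ ℕ), j < i ∧ (∀ k ∈ t.support, j ≤ k) ∧ s = Finsupp.single j 1 + t := by
  by_cases h : ∀ j ∈ s.support, i ≤ j
  · exact Or.inl h
  · right
    push Not at h
    obtain ⟨k, hk, hki⟩ := h
    have hne : s.support.Nonempty := ⟨k, hk⟩
    refine ⟨s.support.min' hne, s - Finsupp.single (s.support.min' hne) 1,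
      lt_of_le_of_lt (Finset.min'_le _ _ hk) hki, fun l hl => Finset.min'_le _ _ ?_, ?_⟩
    · exact Finsupp.support_mono tsub_le_self hl
    · rw [add_tsub_cancel_of_le]
      rw [Finsupp.single_le_iff]
      exact Nat.one_le_iff_ne_zero.2 (Finsupp.mem_support_iff.1 (Finset.min'_mem _ hne))

/-- The leading term of the action is multiplication. This bound keeps the remainders in the
recursion within the degrees where the previous approximation is already correct. -/
theorem pbwAux_sub_mem (N : ℕ) : ∀ (d : ℕ) (_ : d ≤ N) (x : L) (v : MvPolynomial ι F)
    (_ : v ∈ polyFilt ι F d), pbwAux b N x v - toLinearForm b x * v ∈ polyFilt ι F d := by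
  induction N with
  | zero =>
    intro d hd x v hv
    obtain rfl : d = 0 := by omega
    rw [polyFilt_zero, Submodule.mem_bot] at hv
    simp [hv]
  | succ N ih =>
    have ih' : ∀ (d : ℕ) (_ : d ≤ N) (x : L) (v : MvPolynomial ι F) (_ : v ∈ polyFilt ι F d),
        pbwAux b N x v ∈ polyFilt ι F (d + 1) := by
      intro d hd x v hv
      have := Submodule.add_mem _ (polyFilt_mono d.le_succ (ih d hd x v hv))
        (toLinearForm_mul_mem b x hv)
      rwa [sub_add_cancel] at this
    intro d hd x v hv
    refine linear_induction_basis b (T := (pbwAux b (N + 1)).flip v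
      - (LinearMap.mulRight F v) ∘ₗ toLinearForm b) (fun i => ?_) x
    refine map_mem_of_polyFilt (T := pbwAux b (N + 1) (b i)
      - LinearMap.mulLeft F (X i : MvPolynomial ι F)) (fun s hs => ?_) (v := v) hv |> fun h => by
        simpa [toLinearForm_basis] using h
    rw [LinearMap.sub_apply, LinearMap.mulLeft_apply]
    rcases exists_min_variable i s with h | ⟨j, t, hji, ht, rfl⟩
    · rw [pbwAux_succ_of_le b N h, sub_self]
      exact Submodule.zero_mem _
    · rw [map_add, Finsupp.degree_single] at hs
      obtain ⟨d, rfl⟩ : ∃ d', d = d' + 1 := ⟨d - 1, by omega⟩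
      have htm : monomial t (1 : F) ∈ polyFilt ι F d := monomial_mem_polyFilt (by omega)
      rw [pbwAux_succ_of_lt b N ht hji, add_assoc, add_sub_cancel_left]
      refine Submodule.add_mem _ (ih' d (by omega) _ _ ?_) (ih' d (by omega) _ _ htm)
      simpa [toLinearForm_basis] using ih d (by omega) (b i) _ htm

/-- The approximations stabilise, so a limit exists. As `polyFilt` bounds degrees strictly, a
monomial `s` needs stage `s.degree + 1`. -/
theorem pbwAux_succ_eq (N : ℕ) : ∀ (x : L) (v : MvPolynomial ι F) (_ : v ∈ polyFilt ι F N),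
    pbwAux b (N + 1) x v = pbwAux b N x v := by
  induction N with
  | zero =>
    intro x v hv
    rw [polyFilt_zero, Submodule.mem_bot] at hv
    simp [hv]
  | succ N ih =>
    intro x v hv
    rw [← sub_eq_zero, ← Submodule.mem_bot F]
    refine linear_induction_basis b (T := (pbwAux b (N + 2)).flip v - (pbwAux b (N + 1)).flip v)
      (fun i => ?_) x
    refine map_mem_of_polyFilt (T := pbwAux b (N + 2) (b i) - pbwAux b (N + 1) (b i))
      (fun s hs => ?_) hv
    rw [LinearMap.sub_apply, Submodule.mem_bot, sub_eq_zero]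
    rcases exists_min_variable i s with h | ⟨j, t, hji, ht, rfl⟩
    · rw [pbwAux_succ_of_le b _ h, pbwAux_succ_of_le b _ h]
    · rw [map_add, Finsupp.degree_single] at hs
      have htm : monomial t (1 : F) ∈ polyFilt ι F N := monomial_mem_polyFilt (by omega)
      rw [pbwAux_succ_of_lt b _ ht hji, pbwAux_succ_of_lt b _ ht hji, ih _ _ htm, ih _ _ htm, ih]
      simpa [toLinearForm_basis] using pbwAux_sub_mem b N N le_rfl (b i) _ htm

theorem pbwAux_eq_of_le {N M : ℕ} (h : N ≤ M) (x : L) {v : MvPolynomial ι F}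
    (hv : v ∈ polyFilt ι F N) : pbwAux b M x v = pbwAux b N x v := by
  induction M, h using Nat.le_induction with
  | base => rfl
  | succ M hM ih => rw [pbwAux_succ_eq b M x v (polyFilt_mono hM hv), ih]

/-- The action of `L` on the polynomial ring in a basis of `L`, as a linear map. -/
noncomputable def pbwLin : L →ₗ[F] Module.End F (MvPolynomial ι F) where
  toFun x := (basisMonomials ι F).constr F fun s => pbwAux b (s.degree + 1) x (monomial s 1)
  map_add' x y := (basisMonomials ι F).ext fun s => by
    rw [LinearMap.add_apply]; simp only [Module.Basis.constr_basis]; simp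
  map_smul' c x := (basisMonomials ι F).ext fun s => by
    rw [LinearMap.smul_apply]; simp only [Module.Basis.constr_basis]; simp

theorem pbwLin_monomial (x : L) (s : ι →₀ ℕ) :
    pbwLin b x (monomial s 1) = pbwAux b (s.degree + 1) x (monomial s 1) :=
  constr_monomial _ s

theorem pbwLin_eq {N : ℕ} (x : L) {v : MvPolynomial ι F} (hv : v ∈ polyFilt ι F N) :
    pbwLin b x v = pbwAux b N x v := by
  rw [← sub_eq_zero, ← Submodule.mem_bot F]
  refine map_mem_of_polyFilt (T := pbwLin b x - pbwAux b N x) (fun s hs => ?_) hv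
  rw [LinearMap.sub_apply, Submodule.mem_bot, sub_eq_zero, pbwLin_monomial,
    pbwAux_eq_of_le b hs x (monomial_mem_polyFilt (Nat.lt_succ_self _))]

theorem pbwLin_sub_mem {d : ℕ} (x : L) {v : MvPolynomial ι F} (hv : v ∈ polyFilt ι F d) :
    pbwLin b x v - toLinearForm b x * v ∈ polyFilt ι F d := by
  rw [pbwLin_eq b x hv]
  exact pbwAux_sub_mem b d d le_rfl x v hv

theorem pbwLin_mem {d : ℕ} (x : L) {v : MvPolynomial ι F} (hv : v ∈ polyFilt ι F d) :
    pbwLin b x v ∈ polyFilt ι F (d + 1) := by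
  have := Submodule.add_mem _ (polyFilt_mono d.le_succ (pbwLin_sub_mem b x hv))
    (toLinearForm_mul_mem b x hv)
  rwa [sub_add_cancel] at this

theorem pbwLin_of_le {i : ι} {s : ι →₀ ℕ} (h : ∀ j ∈ s.support, i ≤ j) :
    pbwLin b (b i) (monomial s 1) = monomial (Finsupp.single i 1 + s) 1 := by
  rw [pbwLin_monomial, pbwAux_succ_of_le b _ h, X_mul_monomial_one]

theorem le_support_single_add {i j : ι} {t : ι →₀ ℕ} (hij : i ≤ j)
    (hi : ∀ k ∈ t.support, i ≤ k) : ∀ k ∈ (Finsupp.single j 1 + t).support, i ≤ k := by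
  intro k hk
  rcases Finset.mem_union.1 (Finsupp.support_add hk) with h | h
  · exact hij.trans (Finset.mem_singleton.1 (Finsupp.support_single_subset h)).ge
  · exact hi k h

/-- This is the defining recursion, read in the limit. -/
theorem pbwLin_lie_of_lt {i j : ι} {t : ι →₀ ℕ} (hj : ∀ k ∈ t.support, j ≤ k) (hij : j < i) :
    pbwLin b (b i) (pbwLin b (b j) (monomial t 1))
      = pbwLin b (b j) (pbwLin b (b i) (monomial t 1)) + pbwLin b ⁅b i, b j⁆ (monomial t 1) := by
  have htm : monomial t (1 : F) ∈ polyFilt ι F (t.degree + 1) :=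
    monomial_mem_polyFilt (Nat.lt_succ_self _)
  have hd : (Finsupp.single j 1 + t).degree = t.degree + 1 := by
    rw [map_add, Finsupp.degree_single, add_comm]
  rw [pbwLin_of_le b hj, pbwLin_monomial, hd, pbwAux_succ_of_lt b _ hj hij,
    ← pbwLin_eq b _ htm, ← pbwLin_eq b _ htm, ← pbwLin_eq b _ (N := t.degree + 1)
      (by simpa [toLinearForm_basis] using pbwLin_sub_mem b (b i) htm), map_sub,
    X_mul_monomial_one i t, pbwLin_of_le b (le_support_single_add hij.le hj), X_mul_monomial_one,
    add_left_comm (Finsupp.single i 1)]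
  abel

/-- The defect of `pbwLin` from being a representation, at a vector. -/
noncomputable def pbwDefect (x y : L) : Module.End F (MvPolynomial ι F) :=
  pbwLin b x * pbwLin b y - pbwLin b y * pbwLin b x - pbwLin b ⁅x, y⁆

theorem pbwDefect_swap (x y : L) : pbwDefect b y x = - pbwDefect b x y := by
  rw [pbwDefect, pbwDefect, ← lie_skew x y, map_neg]
  abel

theorem pbwDefect_eq_zero_iff (x y : L) (v : MvPolynomial ι F) : pbwDefect b x y v = 0 ↔
    pbwLin b x (pbwLin b y v) = pbwLin b y (pbwLin b x v) + pbwLin b ⁅x, y⁆ v := by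
  rw [pbwDefect, LinearMap.sub_apply, LinearMap.sub_apply, Module.End.mul_apply,
    Module.End.mul_apply, sub_sub, sub_eq_zero]

theorem pbwDefect_of_le {i : ι} (j : ι) {t : ι →₀ ℕ} (hi : ∀ k ∈ t.support, i ≤ k) :
    pbwDefect b (b i) (b j) (monomial t 1) = 0 := by
  rcases lt_trichotomy i j with h | rfl | h
  · rw [pbwDefect_swap, LinearMap.neg_apply, neg_eq_zero, pbwDefect_eq_zero_iff]
    exact pbwLin_lie_of_lt b hi h
  · simp [pbwDefect]
  · rw [pbwDefect_eq_zero_iff]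
    exact pbwLin_lie_of_lt b (fun k hk => h.le.trans (hi k hk)) h

theorem pbwDefect_of_basis {v : MvPolynomial ι F} (h : ∀ i j, pbwDefect b (b i) (b j) v = 0)
    (x y : L) : pbwDefect b x y v = 0 := by
  let T : L →ₗ[F] L →ₗ[F] MvPolynomial ι F := LinearMap.mk₂ F (fun x y => pbwDefect b x y v)
    (fun x x' y => by simp [pbwDefect]; abel)
    (fun c x y => by simp [pbwDefect, smul_sub])
    (fun x y y' => by simp [pbwDefect]; abel)
    (fun c x y => by simp [pbwDefect, smul_sub])
  have : T = 0 := b.ext fun i => b.ext fun j => h i j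
  exact congrArg (fun T => T x y) this

/-- Induction on the degree. The only case not covered by the recursion is a monomial `x_m t` with
`m` smaller than both indices. There `x_m` is moved to the left through both operators and the
Jacobi identity closes the computation. -/
theorem pbwDefect_polyFilt (d : ℕ) : ∀ (x y : L) (v : MvPolynomial ι F) (_ : v ∈ polyFilt ι F d),
    pbwDefect b x y v = 0 := by
  induction d with
  | zero =>
    intro x y v hv
    rw [polyFilt_zero, Submodule.mem_bot] at hv
    simp [hv]
  | succ d ih =>
    intro x y v hv
    rw [← Submodule.mem_bot F]
    refine map_mem_of_polyFilt (fun s hs => ?_) hv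
    rw [Submodule.mem_bot]
    refine pbwDefect_of_basis b (fun i j => ?_) x y
    rcases exists_min_variable i s with h | ⟨m, t, hmi, ht, rfl⟩
    · exact pbwDefect_of_le b j h
    · have htm : monomial t (1 : F) ∈ polyFilt ι F d := by
        refine monomial_mem_polyFilt ?_
        rw [map_add, Finsupp.degree_single] at hs
        omega
      rw [← pbwLin_of_le b ht]
      by_cases hjm : j ≤ m
      · rw [pbwLin_of_le b ht, pbwDefect_swap, LinearMap.neg_apply, neg_eq_zero]
        exact pbwDefect_of_le b i (le_support_single_add hjm fun k hk => hjm.trans (ht k hk))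
      -- The vector `xⱼ t` may have the full degree, so induction alone does not apply. Its leading
      -- term `Xⱼ t` still has all variables at least `m`, where the relation is known, and the rest
      -- has lower degree.
      have key : ∀ i j : ι, m ≤ j → pbwLin b (b i) (pbwLin b (b m) (pbwLin b (b j) (monomial t 1)))
          = pbwLin b (b m) (pbwLin b (b i) (pbwLin b (b j) (monomial t 1)))
            + pbwLin b ⁅b i, b m⁆ (pbwLin b (b j) (monomial t 1)) := by
        intro i j hj
        rw [← pbwDefect_eq_zero_iff]
        have h1 := pbwLin_sub_mem b (b j) htm
        rw [toLinearForm_basis, X_mul_monomial_one] at h1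
        have h2 := ih (b i) (b m) _ h1
        rw [map_sub, sub_eq_zero] at h2
        rw [h2, pbwDefect_swap, LinearMap.neg_apply, neg_eq_zero]
        exact pbwDefect_of_le b i (le_support_single_add hj ht)
      have hC := fun x y => (pbwDefect_eq_zero_iff b x y _).1 (ih x y _ htm)
      rw [pbwDefect_eq_zero_iff, hC (b j) (b m), hC (b i) (b m), map_add, map_add,
        key i j (not_le.1 hjm).le, key j i hmi.le, hC (b i) ⁅b j, b m⁆, hC (b j) ⁅b i, b m⁆,
        hC ⁅b i, b j⁆ (b m), hC (b i) (b j), map_add, lie_lie (b i) (b j) (b m), map_sub,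
        LinearMap.sub_apply]
      abel

/-- The action of `L` on the polynomial ring in a basis of `L`. -/
noncomputable def pbwRep : L →ₗ⁅F⁆ Module.End F (MvPolynomial ι F) :=
  { pbwLin b with
    map_lie' := by
      intro x y
      ext1 s
      refine LinearMap.ext_ring ?_
      have h := pbwDefect_polyFilt b _ x y _
        (monomial_mem_polyFilt (F := F) (Nat.lt_succ_self s.degree))
      rw [pbwDefect, LinearMap.sub_apply, sub_eq_zero] at h
      exact h.symm }

theorem pbwRep_sub_mem {d : ℕ} (x : L) {v : MvPolynomial ι F} (hv : v ∈ polyFilt ι F d) :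
    pbwRep b x v - toLinearForm b x * v ∈ polyFilt ι F d :=
  pbwLin_sub_mem b x hv

end PBW

/-! ### Powers of `ad` in characteristic `p`. -/

section CharacteristicP

variable {F : Type*} [Field F] (p : ℕ) [Fact p.Prime] [CharP F p]

theorem cast_choose_prime_sub_one {j : ℕ} (hj : j ≤ p - 1) :
    ((p - 1).choose j : F) = (-1) ^ j := by
  have hp : p.Prime := Fact.out
  induction j with
  | zero => simp
  | succ j ih =>
    have h1 : p.choose (j + 1) = (p - 1).choose j + (p - 1).choose (j + 1) := by
      conv_lhs => rw [← Nat.sub_add_cancel hp.one_le, Nat.choose_succ_succ]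
    have h2 : ((p.choose (j + 1) : ℕ) : F) = 0 :=
      (CharP.cast_eq_zero_iff F p _).2 (hp.dvd_choose_self (Nat.succ_ne_zero j) (by omega))
    rw [h1, Nat.cast_add, ih (by omega)] at h2
    rw [pow_succ, mul_neg_one]
    exact eq_neg_of_add_eq_zero_right h2

/-- The binomial coefficients `(p - 1).choose j` are `(-1) ^ j`, which cancels the signs. For left
and right multiplication by `c` this computes `ad(c) ^ (p - 1)`. -/
theorem sub_pow_prime_sub_one_of_commute {E : Type*} [Ring E] [Algebra F E] {l r : E}
    (h : Commute l r) :
    (l - r) ^ (p - 1) = ∑ j ∈ Finset.range (p - 1 + 1), l ^ j * r ^ (p - 1 - j) := by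
  have hone : ((-1 : F)) ^ (p - 1) = 1 := by
    rw [← cast_choose_prime_sub_one (F := F) p le_rfl, Nat.choose_self, Nat.cast_one]
  rw [sub_eq_add_neg, (h.neg_right).add_pow]
  refine Finset.sum_congr rfl fun j hj => ?_
  have hj' : j ≤ p - 1 := Nat.lt_succ_iff.1 (Finset.mem_range.1 hj)
  have h1 : (((p - 1).choose j : ℕ) : E) = algebraMap F E ((-1) ^ j) := by
    rw [← cast_choose_prime_sub_one p hj', map_natCast]
  have h2 : (-r) ^ (p - 1 - j) = algebraMap F E ((-1) ^ (p - 1 - j)) * r ^ (p - 1 - j) := by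
    rw [neg_pow]
    simp
  rw [h1, h2, ← Algebra.commutes, ← mul_assoc, ← mul_assoc, ← Algebra.commutes, ← mul_assoc,
    ← map_mul, ← pow_add, Nat.sub_add_cancel hj', hone, map_one, one_mul]

theorem sub_pow_prime_of_commute {E : Type*} [Ring E] [Algebra F E] {l r : E}
    (h : Commute l r) : (l - r) ^ p = l ^ p - r ^ p := by
  rcases subsingleton_or_nontrivial E with hE | hE
  · exact Subsingleton.elim _ _
  · have : CharP E p := charP_of_injective_algebraMap (algebraMap F E).injective p
    exact sub_pow_char_of_commute _ h

variable {A : Type*} [Ring A] [Algebra F A]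

theorem commute_mulLeft_mulRight (c : A) :
    Commute (LinearMap.mulLeft F c) (LinearMap.mulRight F c) := by
  ext t
  simp [mul_assoc]

theorem ad_eq_mulLeft_sub_mulRight (c : A) :
    LieAlgebra.ad F A c = LinearMap.mulLeft F c - LinearMap.mulRight F c := by
  ext t
  simp [LieRing.of_associative_ring_bracket]

theorem ad_pow_prime_apply (c t : A) : (LieAlgebra.ad F A c ^ p) t = ⁅c ^ p, t⁆ := by
  rw [ad_eq_mulLeft_sub_mulRight, sub_pow_prime_of_commute (F := F) p (commute_mulLeft_mulRight c),
    LinearMap.pow_mulLeft, LinearMap.pow_mulRight]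
  simp [LieRing.of_associative_ring_bracket]

theorem ad_pow_prime_sub_one_apply (c t : A) : (LieAlgebra.ad F A c ^ (p - 1)) t
    = ∑ j ∈ Finset.range (p - 1 + 1), c ^ j * t * c ^ (p - 1 - j) := by
  rw [ad_eq_mulLeft_sub_mulRight,
    sub_pow_prime_sub_one_of_commute (F := F) p (commute_mulLeft_mulRight c), LinearMap.sum_apply]
  refine Finset.sum_congr rfl fun j _ => ?_
  rw [LinearMap.pow_mulLeft, LinearMap.pow_mulRight, Module.End.mul_apply,
    LinearMap.mulLeft_apply, LinearMap.mulRight_apply, mul_assoc]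

end CharacteristicP

/-! ### Jacobson's formula and semilinearity of the `p`-character. -/

section Jacobson

open Polynomial

theorem derivative_pow_succ_noncomm {A : Type*} [Ring A] (c : A[X]) (n : ℕ) :
    derivative (c ^ (n + 1))
      = ∑ j ∈ Finset.range (n + 1), c ^ j * derivative c * c ^ (n - j) := by
  induction n with
  | zero => simp
  | succ n ih =>
    rw [pow_succ', derivative_mul, ih, Finset.sum_range_succ' _ (n + 1), Finset.mul_sum, add_comm]
    congr 1
    · refine Finset.sum_congr rfl fun j _ => ?_
      rw [Nat.add_sub_add_right, pow_succ', mul_assoc, mul_assoc, mul_assoc]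
    · simp

variable {F L A : Type*} [Field F] [LieRing L] [LieAlgebra F L] [Ring A] [Algebra F A]

/-- The map `F[X] ⊗ L → A[X]` induced by a linear map `L → A`. -/
noncomputable def polyExtend (f : L →ₗ[F] A) : F[X] ⊗[F] L →ₗ[F] A[X] :=
  TensorProduct.lift (LinearMap.mk₂ F (fun P x => P.map (algebraMap F A) * C (f x))
    (fun P Q x => by rw [Polynomial.map_add, add_mul])
    (fun c P x => by
      rw [Algebra.smul_def c P, Polynomial.map_mul, Algebra.smul_def, mul_assoc]
      congr 1
      simp [Polynomial.algebraMap_apply])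
    (fun P x y => by rw [map_add, C_add, mul_add])
    (fun c P x => by
      rw [map_smul, ← Polynomial.smul_C, mul_smul_comm]))

theorem polyExtend_tmul (f : L →ₗ[F] A) (P : F[X]) (x : L) :
    polyExtend f (P ⊗ₜ x) = P.map (algebraMap F A) * C (f x) := by
  rw [polyExtend, TensorProduct.lift.tmul, LinearMap.mk₂_apply]

theorem commute_map_algebraMap (P : F[X]) (Q : A[X]) : Commute (P.map (algebraMap F A)) Q := by
  induction P using Polynomial.induction_on' with
  | add P P' h h' => rw [Polynomial.map_add]; exact h.add_left h'
  | monomial n c =>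
    rw [Polynomial.map_monomial, ← C_mul_X_pow_eq_monomial]
    refine Commute.mul_left ?_ (Polynomial.commute_X_pow Q n)
    rw [← Polynomial.algebraMap_apply]
    exact Algebra.commutes c Q

theorem polyExtend_lie (f : L →ₗ⁅F⁆ A) (u t : F[X] ⊗[F] L) :
    polyExtend (f : L →ₗ[F] A) (LieAlgebra.ad F[X] (F[X] ⊗[F] L) u t)
      = ⁅polyExtend (f : L →ₗ[F] A) u, polyExtend (f : L →ₗ[F] A) t⁆ := by
  induction u using TensorProduct.induction_on with
  | zero => simp
  | add u u' h h' => rw [map_add, LinearMap.add_apply, map_add, map_add, add_lie, h, h']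
  | tmul P x =>
    induction t using TensorProduct.induction_on with
    | zero => simp
    | add t t' h h' => rw [map_add, map_add, map_add, lie_add, h, h']
    | tmul Q y =>
      rw [LieAlgebra.ad_apply, LieAlgebra.ExtendScalars.bracket_tmul, polyExtend_tmul, polyExtend_tmul,
        polyExtend_tmul,
        LieRing.of_associative_ring_bracket, Polynomial.map_mul]
      have h1 := commute_map_algebraMap (A := A) P
      have h2 := commute_map_algebraMap (A := A) Q
      simp only [LieHom.coe_toLinearMap, LieHom.map_lie, LieRing.of_associative_ring_bracket, C_sub,
        C_mul, mul_sub]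
      congr 1
      · rw [mul_assoc, mul_assoc, (h2 _).left_comm]
      · rw [mul_assoc, mul_assoc, (h1 _).left_comm, (h1 (C (f y))).symm.left_comm]

theorem coeff_polyExtend (f : L →ₗ[F] A) (n : ℕ) (t : F[X] ⊗[F] L) :
    (polyExtend f t).coeff n
      = f (TensorProduct.lid F L (LinearMap.rTensor L (Polynomial.lcoeff F n) t)) := by
  induction t using TensorProduct.induction_on with
  | zero => simp
  | add t t' h h' => simp [h, h']
  | tmul P x =>
    rw [polyExtend_tmul, coeff_mul_C, coeff_map, LinearMap.rTensor_tmul, TensorProduct.lid_tmul,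
      map_smul, Algebra.smul_def, lcoeff_apply]

variable (p : ℕ) [hp : Fact p.Prime] [CharP F p]

/-- The noncommutative polynomial `(X a + b) ^ p` has the coefficients `s_i(a, b)`. -/
theorem map_jacobsonTerm (f : L →ₗ⁅F⁆ A) (a b : L) {i : ℕ} (hi : i ∈ Finset.Icc 1 (p - 1)) :
    f (jacobsonTerm (F := F) p i a b) = ((X * C (f a) + C (f b)) ^ p : A[X]).coeff i := by
  obtain ⟨h1, h2⟩ := Finset.mem_Icc.1 hi
  have hp1 := hp.out.one_lt
  set c : A[X] := X * C (f a) + C (f b) with hc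
  have hext : ∀ (n : ℕ) (t : F[X] ⊗[F] L), polyExtend (f : L →ₗ[F] A)
      ((LieAlgebra.ad F[X] (F[X] ⊗[F] L) ((X : F[X]) ⊗ₜ[F] a + (1 : F[X]) ⊗ₜ[F] b) ^ n) t)
      = (LieAlgebra.ad F A[X] c ^ n) (polyExtend (f : L →ₗ[F] A) t) := by
    intro n
    induction n with
    | zero => intro t; simp
    | succ n ih =>
      intro t
      have hu : polyExtend (f : L →ₗ[F] A) ((X : F[X]) ⊗ₜ[F] a + (1 : F[X]) ⊗ₜ[F] b) = c := by
        rw [map_add, polyExtend_tmul, polyExtend_tmul, Polynomial.map_X, Polynomial.map_one,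
          one_mul]
        rfl
      rw [pow_succ, Module.End.mul_apply, ih, pow_succ, Module.End.mul_apply, polyExtend_lie, hu,
        LieAlgebra.ad_apply]
  have hder : derivative c = C (f a) := by simp [hc]
  -- With `c = X a + b`, the Leibniz rule gives `(c^p)' = ∑ c^j a c^(p-1-j)`, which is
  -- `ad(c)^(p-1)(a)`. Thus `s_i` is recovered by dividing the coefficient of `X^(i-1)` in the
  -- derivative by `i`.
  have key : polyExtend (f : L →ₗ[F] A)
      ((LieAlgebra.ad F[X] (F[X] ⊗[F] L) ((X : F[X]) ⊗ₜ[F] a + (1 : F[X]) ⊗ₜ[F] b) ^ (p - 1))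
        ((1 : F[X]) ⊗ₜ[F] a)) = derivative (c ^ p) := by
    rw [hext, ad_pow_prime_sub_one_apply, polyExtend_tmul, Polynomial.map_one, one_mul,
      LieHom.coe_toLinearMap, ← hder, ← derivative_pow_succ_noncomm,
      Nat.sub_add_cancel hp.out.one_le]
  have hi0 : (i : F) ≠ 0 := by
    rw [Ne, CharP.cast_eq_zero_iff F p]
    exact fun h => absurd (Nat.le_of_dvd h1 h) (by omega)
  have hco := coeff_polyExtend (f : L →ₗ[F] A) (i - 1)
    ((LieAlgebra.ad F[X] (F[X] ⊗[F] L) ((X : F[X]) ⊗ₜ[F] a + (1 : F[X]) ⊗ₜ[F] b) ^ (p - 1))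
        ((1 : F[X]) ⊗ₜ[F] a))
  rw [key, coeff_derivative, Nat.sub_add_cancel h1] at hco
  rw [jacobsonTerm, map_smul]
  rw [LieHom.coe_toLinearMap] at hco
  have hcast : ((i - 1 : ℕ) : A) + 1 = (i : A) := by
    rw [← Nat.cast_add_one, Nat.sub_add_cancel h1]
  rw [← hco, hcast, ← map_natCast (algebraMap F A),
    ← Algebra.commutes, ← Algebra.smul_def, smul_smul, inv_mul_cancel₀ hi0, one_smul]

/-- Jacobson's formula for `(a + b) ^ p`. -/
theorem map_add_pow_prime (f : L →ₗ⁅F⁆ A) (a b : L) :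
    f (a + b) ^ p = f a ^ p + f b ^ p
      + ∑ i ∈ Finset.Icc 1 (p - 1), f (jacobsonTerm (F := F) p i a b) := by
  have hp1 := hp.out.one_lt
  set c : A[X] := X * C (f a) + C (f b) with hc
  have hdeg : c.natDegree ≤ 1 := by
    refine natDegree_add_le_of_degree_le ?_ (by simp)
    refine natDegree_mul_le.trans ?_
    rw [natDegree_C, add_zero]
    exact natDegree_X_le
  have heval : eval 1 (c ^ p) = f (a + b) ^ p := by
    -- Evaluation at `1` is multiplicative over the noncommutative ring `A` because `1` is central.
    have h1 := (eval₂RingHom' (RingHom.id A) 1 (fun a => Commute.one_right a)).map_pow c p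
    have h2 : eval₂ (RingHom.id A) 1 c = f (a + b) := by
      rw [hc, X_mul_C, eval₂_add, eval₂_mul_X, eval₂_C, eval₂_C, mul_one, map_add]
      rfl
    change eval₂ (RingHom.id A) 1 (c ^ p) = eval₂ (RingHom.id A) 1 c ^ p at h1
    rw [eval, h1, h2]
  have h0 : (c ^ p).coeff 0 = f b ^ p := by
    have h1 := (constantCoeff (R := A)).map_pow c p
    simpa [hc] using h1
  have hpp : (c ^ p).coeff p = f a ^ p := by
    have := coeff_pow_of_natDegree_le (m := p) hdeg
    rw [mul_one] at this
    rw [this]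
    simp [hc]
  rw [← heval, eval_eq_sum_range' (n := p + 1)
    (Nat.lt_succ_of_le (natDegree_pow_le.trans (by simpa using Nat.mul_le_mul_left p hdeg))),
    Finset.sum_range_succ, hpp]
  rw [Finset.range_eq_Ico, Finset.sum_eq_sum_Ico_succ_bot hp.out.pos, h0]
  simp only [one_pow, mul_one]
  have hI : Finset.Ico (0 + 1) p = Finset.Icc 1 (p - 1) := by
    ext i
    simp only [Finset.mem_Ico, Finset.mem_Icc]
    omega
  rw [hI, Finset.sum_congr rfl fun i hi => map_jacobsonTerm p f a b hi]
  abel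

/-- The elements on which a Lie homomorphism to an associative algebra has `p`-character `S` form
a subspace. -/
def characterSubspace {q : L → L} (hq : IsPMapping F p q) (S : Module.Dual F L) (f : L →ₗ⁅F⁆ A) :
    Submodule F L where
  carrier := {x | f x ^ p = f (q x) + algebraMap F A (S x ^ p)}
  add_mem' {a b} ha hb := by
    simp only [Set.mem_ofPred_eq] at ha hb ⊢
    -- The same terms `s_i(a, b)` correct the `p`-th power and the `p`-mapping, so they cancel.
    rw [map_add_pow_prime p f, ha, hb, hq.add, map_add, map_add, map_add, map_sum,
      add_pow_char, map_add]
    abel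
  zero_mem' := by
    have h := hq.smul 0 0
    simp only [zero_smul, zero_pow hp.out.ne_zero] at h
    simp [h, zero_pow hp.out.ne_zero]
  smul_mem' c a ha := by
    simp only [Set.mem_ofPred_eq] at ha ⊢
    rw [map_smul, _root_.smul_pow, ha, hq.smul, map_smul, map_smul, smul_eq_mul, mul_pow, map_mul,
      smul_add, Algebra.smul_def (c ^ p) (algebraMap F A _)]

end Jacobson

/-! ### Leading terms of operators on polynomials. -/

section Symbols

variable {ι F : Type*} [Field F]

/-- The operator `T` on polynomials agrees with multiplication by `g`, which raises degrees by at
most `e`, up to terms of lower degree. -/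
structure HasSymbol (T : Module.End F (MvPolynomial ι F)) (g : MvPolynomial ι F) (e : ℕ) :
    Prop where
  sub_mem : ∀ (d : ℕ) (v : MvPolynomial ι F), v ∈ polyFilt ι F (d + 1) →
    T v - g * v ∈ polyFilt ι F (d + e)
  mul_mem : ∀ (d : ℕ) (v : MvPolynomial ι F), v ∈ polyFilt ι F d → g * v ∈ polyFilt ι F (d + e)

namespace HasSymbol

variable {T T' : Module.End F (MvPolynomial ι F)} {g g' : MvPolynomial ι F} {e e' : ℕ}

theorem apply_mem (h : HasSymbol T g e) {d : ℕ} {v : MvPolynomial ι F}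
    (hv : v ∈ polyFilt ι F d) : T v ∈ polyFilt ι F (d + e) := by
  rcases d with _ | d
  · rw [polyFilt_zero, Submodule.mem_bot] at hv
    simp [hv]
  · have := Submodule.add_mem _ (polyFilt_mono (by omega) (h.sub_mem d v hv)) (h.mul_mem _ v hv)
    rwa [sub_add_cancel] at this

theorem one : HasSymbol (1 : Module.End F (MvPolynomial ι F)) 1 0 :=
  ⟨fun d v _ => by simp, fun d v hv => by simpa using hv⟩

theorem mul (h : HasSymbol T g e) (h' : HasSymbol T' g' e') :
    HasSymbol (T * T') (g * g') (e + e') := by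
  constructor
  · intro d v hv
    have h1 := h.apply_mem (h'.sub_mem d v hv)
    have h2 := h.sub_mem (d + e') (g' * v) (by
      rw [Nat.add_right_comm]
      exact h'.mul_mem _ _ hv)
    have h3 := Submodule.add_mem _ h1 h2
    rw [map_sub, sub_add_sub_cancel, add_assoc, add_comm e' e] at h3
    rw [Module.End.mul_apply, mul_assoc]
    exact h3
  · intro d v hv
    have h1 := h.mul_mem _ _ (h'.mul_mem d v hv)
    rwa [add_assoc, add_comm e' e, ← mul_assoc] at h1

theorem pow (h : HasSymbol T g e) (n : ℕ) : HasSymbol (T ^ n) (g ^ n) (n * e) := by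
  induction n with
  | zero => simpa using one
  | succ n ih =>
    rw [pow_succ, pow_succ, Nat.succ_mul]
    exact ih.mul h

theorem sub_of_lower (h : HasSymbol T g e)
    (hlow : ∀ (d : ℕ) (v : MvPolynomial ι F), v ∈ polyFilt ι F (d + 1) →
      T' v ∈ polyFilt ι F (d + e)) : HasSymbol (T - T') g e := by
  refine ⟨fun d v hv => ?_, h.mul_mem⟩
  have := Submodule.sub_mem _ (h.sub_mem d v hv) (hlow d v hv)
  rwa [sub_right_comm] at this

theorem listProd {n : ℕ} {T : Fin n → Module.End F (MvPolynomial ι F)}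
    {g : Fin n → MvPolynomial ι F} {e : Fin n → ℕ} (h : ∀ i, HasSymbol (T i) (g i) (e i)) :
    HasSymbol (List.ofFn T).prod (∏ i, g i) (∑ i, e i) := by
  induction n with
  | zero => simpa using one
  | succ n ih =>
    rw [List.ofFn_succ, List.prod_cons, Fin.prod_univ_succ, Fin.sum_univ_succ]
    exact (h 0).mul (ih fun i => h i.succ)

end HasSymbol

/-- Such a map is unitriangular for the degree filtration. A kernel element descends through all
degrees to zero, and preimages are built up by degree. -/
theorem bijective_of_sub_mem {Ψ : Module.End F (MvPolynomial ι F)}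
    (h : ∀ s : ι →₀ ℕ, Ψ (MvPolynomial.monomial s 1) - MvPolynomial.monomial s 1
      ∈ polyFilt ι F s.degree) : Function.Bijective Ψ := by
  have hlow : ∀ (d : ℕ) (v : MvPolynomial ι F), v ∈ polyFilt ι F (d + 1) →
      Ψ v - v ∈ polyFilt ι F d := fun d v hv =>
    map_mem_of_polyFilt (T := Ψ - 1) (fun s hs => polyFilt_mono (Nat.lt_succ_iff.1 hs) (h s)) hv
  constructor
  · refine (injective_iff_map_eq_zero Ψ).2 fun v hv => ?_
    obtain ⟨d, hd⟩ := exists_mem_polyFilt v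
    induction d with
    | zero => rwa [polyFilt_zero, Submodule.mem_bot] at hd
    | succ d ih =>
      refine ih ?_
      have := hlow d v hd
      rwa [hv, zero_sub, neg_mem_iff] at this
  · intro v
    obtain ⟨d, hd⟩ := exists_mem_polyFilt v
    have : ∀ (d : ℕ), polyFilt ι F d ≤ LinearMap.range Ψ := by
      intro d
      induction d with
      | zero => rw [polyFilt_zero]; exact bot_le
      | succ d ih =>
        intro v hv
        have := Submodule.sub_mem _ (LinearMap.mem_range_self Ψ v) (ih (hlow d v hv))
        rwa [sub_sub_cancel] at this
    exact this d hd

end Symbols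

/-! ### Ordered monomials. -/

section OrderedMonomials

/-- The ordered monomial `f 0 ^ s 0 * f 1 ^ s 1 * ⋯`. -/
def ordMonomial {A : Type*} [Monoid A] {n : ℕ} (f : Fin n → A) (s : Fin n → ℕ) : A :=
  (List.ofFn fun i => f i ^ s i).prod

theorem map_ordMonomial {A B G : Type*} [Monoid A] [Monoid B] [FunLike G A B]
    [MonoidHomClass G A B] (φ : G) {n : ℕ} (f : Fin n → A) (s : Fin n → ℕ) :
    φ (ordMonomial f s) = ordMonomial (fun i => φ (f i)) s := by
  rw [ordMonomial, map_list_prod, List.map_ofFn, ordMonomial]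
  congr 2
  funext i
  exact map_pow φ _ _

theorem map_ordMonomial_apply {F V W : Type*} [Field F] [AddCommGroup V] [Module F V]
    [AddCommGroup W] [Module F W] (e : V →ₗ[F] W) {n : ℕ} {T : Fin n → Module.End F V}
    {T' : Fin n → Module.End F W} (h : ∀ i v, e (T i v) = T' i (e v)) (s : Fin n → ℕ) (v : V) :
    e (ordMonomial T s v) = ordMonomial T' s (e v) := by
  have hpow : ∀ i (m : ℕ) v, e ((T i ^ m) v) = (T' i ^ m) (e v) := by
    intro i m
    induction m with
    | zero => intro v; rfl
    | succ m ih => intro v; rw [pow_succ, pow_succ, Module.End.mul_apply, ih, h]; rfl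
  rw [ordMonomial, ordMonomial]
  induction n with
  | zero => simp
  | succ n ih =>
    rw [List.ofFn_succ, List.ofFn_succ, List.prod_cons, List.prod_cons, Module.End.mul_apply,
      Module.End.mul_apply, hpow, ih (fun i => h i.succ) (fun i => s i.succ) fun i => hpow i.succ]

theorem ordMonomial_eq_prod {A : Type*} [CommMonoid A] {n : ℕ} (f : Fin n → A) (s : Fin n → ℕ) :
    ordMonomial f s = ∏ i, f i ^ s i :=
  List.prod_ofFn

end OrderedMonomials

/-! ### Independence of the reduced ordered monomials in `u(L, S)`. -/

section Independence

open UniversalEnvelopingAlgebra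

variable {F L : Type*} [Field F] [LieRing L] [LieAlgebra F L]

/-- By the universal property the identity of `U(L)` factors through the centralizer of `z`, which
contains the image of `L`. -/
theorem commute_of_commute_ι {z : UniversalEnvelopingAlgebra F L}
    (h : ∀ x : L, Commute z (UniversalEnvelopingAlgebra.ι F x)) (t : UniversalEnvelopingAlgebra F L) :
    Commute z t := by
  let C := Subalgebra.centralizer F {z}
  have hC : ∀ x : L, UniversalEnvelopingAlgebra.ι F x ∈ C := fun x => by
    rw [Subalgebra.mem_centralizer_iff]
    rintro _ rfl
    exact h x
  let f : L →ₗ⁅F⁆ C :=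
    { toFun := fun x => ⟨UniversalEnvelopingAlgebra.ι F x, hC x⟩
      map_add' := fun x y => Subtype.ext (map_add _ x y)
      map_smul' := fun c x => Subtype.ext (map_smul _ c x)
      map_lie' := fun {x y} => Subtype.ext (LieHom.map_lie _ x y) }
  have hid : C.val.comp (UniversalEnvelopingAlgebra.lift F f) = AlgHom.id F _ := by
    ext x
    simp only [LieHom.comp_apply, AlgHom.coe_toLieHom, AlgHom.comp_apply,
      UniversalEnvelopingAlgebra.lift_ι_apply]
    rfl
  have ht : t ∈ C := by
    have := congrArg (fun φ => φ t) hid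
    simp only [AlgHom.comp_apply, AlgHom.id_apply] at this
    rw [← this]
    exact (UniversalEnvelopingAlgebra.lift F f t).2
  exact (Subalgebra.mem_centralizer_iff F).1 ht z rfl

variable (p : ℕ) [hp : Fact p.Prime]

/-- The element `x ^ p - x ^ [p] - S(x) ^ p` of `U(L)`. -/
noncomputable def pCentral (q : L → L) (S : Module.Dual F L) (x : L) :
    UniversalEnvelopingAlgebra F L :=
  UniversalEnvelopingAlgebra.ι F x ^ p - UniversalEnvelopingAlgebra.ι F (q x)
    - algebraMap F _ (S x ^ p)

theorem map_ad_pow {A : Type*} [Ring A] [Algebra F A] (f : L →ₗ⁅F⁆ A) (x y : L) (n : ℕ) :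
    f ((LieAlgebra.ad F L x ^ n) y) = (LieAlgebra.ad F A (f x) ^ n) (f y) := by
  induction n generalizing y with
  | zero => rfl
  | succ n ih =>
    rw [pow_succ, Module.End.mul_apply, ih, pow_succ, Module.End.mul_apply, LieAlgebra.ad_apply,
      LieAlgebra.ad_apply, LieHom.map_lie]

variable {q : L → L}

/-- Both `x^p` and `x^[p]` act on `L` by commutators as `ad(x)^p`: the first since left and right
multiplication commute in characteristic `p`, the second by definition of a `p`-mapping. -/
theorem pCentral_mem_center [CharP F p]
    (hq : IsPMapping F p q) (S : Module.Dual F L) (x : L) :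
    pCentral p q S x ∈ Subalgebra.center F (UniversalEnvelopingAlgebra F L) := by
  rw [Subalgebra.mem_center_iff]
  intro t
  refine (commute_of_commute_ι (fun y => ?_) t).symm
  refine Commute.sub_left ?_ (Algebra.commutes _ _)
  have h1 : UniversalEnvelopingAlgebra.ι F ⁅q x, y⁆
      = ⁅UniversalEnvelopingAlgebra.ι F x ^ p, UniversalEnvelopingAlgebra.ι F y⁆ := by
    rw [← LieAlgebra.ad_apply F, hq.ad_apply, map_ad_pow, ad_pow_prime_apply]
  rw [LieHom.map_lie, LieRing.of_associative_ring_bracket,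
    LieRing.of_associative_ring_bracket] at h1
  rw [commute_iff_eq, sub_mul, mul_sub, sub_eq_sub_iff_sub_eq_sub]
  exact h1.symm

variable {n : ℕ}

/-- The action of `U(L)` on the polynomial ring. -/
noncomputable def pbwHom
    (b : Module.Basis (Fin n) F L) :
    UniversalEnvelopingAlgebra F L →ₐ[F] Module.End F (MvPolynomial (Fin n) F) :=
  UniversalEnvelopingAlgebra.lift F (pbwRep b)

theorem pbwHom_ι
    (b : Module.Basis (Fin n) F L)
    (x : L) : pbwHom b (UniversalEnvelopingAlgebra.ι F x) = pbwRep b x :=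
  UniversalEnvelopingAlgebra.lift_ι_apply F (pbwRep b) x

theorem pbwRep_hasSymbol
    (b : Module.Basis (Fin n) F L)
    (i : Fin n) : HasSymbol (pbwRep b (b i)) (MvPolynomial.X i) 1 := by
  refine ⟨fun d v hv => ?_, fun d v hv => X_mul_mem_polyFilt i hv⟩
  have := pbwRep_sub_mem b (b i) hv
  rwa [toLinearForm_basis] at this

theorem pbwRep_mem
    (b : Module.Basis (Fin n) F L)
    (x : L) {d : ℕ} {v : MvPolynomial (Fin n) F} (hv : v ∈ polyFilt (Fin n) F d) :
    pbwRep b x v ∈ polyFilt (Fin n) F (d + 1) :=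
  pbwLin_mem b x hv

/-- The term `x^[p]` raises degrees by at most `1 < p` and the scalar by `0`, so only `x^p`
contributes to the leading term. -/
theorem pbwHom_pCentral_hasSymbol
    (S : Module.Dual F L) (b : Module.Basis (Fin n) F L) (i : Fin n) :
    HasSymbol (pbwHom b (pCentral p q S (b i))) (MvPolynomial.X i ^ p) p := by
  have h2 := hp.out.two_le
  have h1 := (pbwRep_hasSymbol b i).pow p
  rw [mul_one] at h1
  rw [pCentral, map_sub, map_sub, map_pow, pbwHom_ι, pbwHom_ι, AlgHom.commutes]
  refine (h1.sub_of_lower fun d v hv => ?_).sub_of_lower fun d v hv => ?_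
  · exact polyFilt_mono (by omega) (pbwRep_mem b _ hv)
  · rw [Algebra.algebraMap_eq_smul_one]
    exact polyFilt_mono (by omega) (Submodule.smul_mem _ _ hv)

variable [CharP F p]

/-- The product of powers of the central elements `pCentral`. -/
noncomputable def pCentralMonomial
    (hq : IsPMapping F p q) (S : Module.Dual F L) (b : Module.Basis (Fin n) F L) (a : Fin n → ℕ) :
    Subalgebra.center F (UniversalEnvelopingAlgebra F L) :=
  ∏ i, (⟨_, pCentral_mem_center p hq S (b i)⟩ :
    Subalgebra.center F (UniversalEnvelopingAlgebra F L)) ^ a i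

theorem pbwHom_pCentralMonomial_hasSymbol
    (hq : IsPMapping F p q) (S : Module.Dual F L) (b : Module.Basis (Fin n) F L) (a : Fin n → ℕ) :
    HasSymbol (pbwHom b (pCentralMonomial p hq S b a))
      (∏ i, (MvPolynomial.X i ^ p) ^ a i) (∑ i, a i * p) := by
  have : pbwHom b (pCentralMonomial p hq S b a)
      = (List.ofFn fun i => pbwHom b (pCentral p q S (b i)) ^ a i).prod := by
    rw [pCentralMonomial, ← ordMonomial_eq_prod]
    exact map_ordMonomial ((pbwHom b).comp (Subalgebra.val _)) _ _
  rw [this]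
  exact HasSymbol.listProd fun i => (pbwHom_pCentral_hasSymbol p S b i).pow (a i)

/-- The monomial in the elements `b i` of exponent `s`, with `(b i) ^ p` replaced by the central
element `pCentral (b i)`. -/
noncomputable def mixedMonomial
    (hq : IsPMapping F p q) (S : Module.Dual F L) (b : Module.Basis (Fin n) F L)
    (s : Fin n →₀ ℕ) : UniversalEnvelopingAlgebra F L :=
  pCentralMonomial p hq S b (fun i => s i / p)
    * ordMonomial (fun i => UniversalEnvelopingAlgebra.ι F (b i)) (fun i => s i % p)

theorem pbwHom_mixedMonomial_sub_mem
    (hq : IsPMapping F p q) (S : Module.Dual F L) (b : Module.Basis (Fin n) F L) (s : Fin n →₀ ℕ) :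
    pbwHom b (mixedMonomial p hq S b s) 1 - MvPolynomial.monomial s 1
      ∈ polyFilt (Fin n) F s.degree := by
  have h1 : HasSymbol (pbwHom b (ordMonomial (fun i => UniversalEnvelopingAlgebra.ι F (b i))
      (fun i => s i % p))) (∏ i, MvPolynomial.X i ^ (s i % p)) (∑ i, s i % p) := by
    rw [map_ordMonomial]
    refine HasSymbol.listProd fun i => ?_
    simp only [pbwHom_ι]
    simpa using (pbwRep_hasSymbol b i).pow (s i % p)
  have h2 := (pbwHom_pCentralMonomial_hasSymbol p hq S b fun i => s i / p).mul h1
  have h3 : (∏ i, (MvPolynomial.X i ^ p) ^ (s i / p)) * ∏ i, MvPolynomial.X i ^ (s i % p)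
      = MvPolynomial.monomial s (1 : F) := by
    rw [← Finset.prod_mul_distrib, MvPolynomial.monomial_eq, map_one, one_mul,
      Finsupp.prod_fintype _ _ (by simp)]
    refine Finset.prod_congr rfl fun i _ => ?_
    rw [← pow_mul, ← pow_add, Nat.div_add_mod]
  have h4 : (∑ i, s i / p * p) + ∑ i, s i % p = s.degree := by
    rw [← Finset.sum_add_distrib, Finsupp.degree_eq_sum]
    exact Finset.sum_congr rfl fun i _ => Nat.div_add_mod' _ _
  rw [← map_mul, h3, h4] at h2
  have h5 : (1 : MvPolynomial (Fin n) F) ∈ polyFilt (Fin n) F (0 + 1) :=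
    monomial_mem_polyFilt (s := 0) (by simp)
  have h6 := h2.sub_mem 0 1 h5
  rwa [mul_one, zero_add] at h6

/-- The linear map sending each monomial to the corresponding mixed monomial. -/
noncomputable def mixedMap
    (hq : IsPMapping F p q) (S : Module.Dual F L) (b : Module.Basis (Fin n) F L)
    : Module.End F (MvPolynomial (Fin n) F) :=
  (MvPolynomial.basisMonomials (Fin n) F).constr F fun s => pbwHom b (mixedMonomial p hq S b s) 1

theorem mixedMap_monomial
    (hq : IsPMapping F p q) (S : Module.Dual F L) (b : Module.Basis (Fin n) F L)
    (s : Fin n →₀ ℕ) : mixedMap p hq S b (MvPolynomial.monomial s 1)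
    = pbwHom b (mixedMonomial p hq S b s) 1 :=
  constr_monomial _ s

/-- Applied to the vector `1`, the mixed monomial of exponent `s` has leading term `X^s`. The mixed
monomials therefore produce another basis of the polynomial ring, adapted to the central elements.
-/
theorem mixedMap_bijective
    (hq : IsPMapping F p q) (S : Module.Dual F L) (b : Module.Basis (Fin n) F L)
    : Function.Bijective (mixedMap p hq S b) :=
  bijective_of_sub_mem fun s => by
    rw [mixedMap_monomial]
    exact pbwHom_mixedMonomial_sub_mem p hq S b s

theorem pCentral_mul_mixedMonomial
    (hq : IsPMapping F p q) (S : Module.Dual F L) (b : Module.Basis (Fin n) F L)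
    (i : Fin n) (s : Fin n →₀ ℕ) :
    pCentral p q S (b i) * mixedMonomial p hq S b s
      = mixedMonomial p hq S b (Finsupp.single i p + s) := by
  have hmod : ∀ j, (Finsupp.single i p + s) j % p = s j % p := by
    intro j
    by_cases h : i = j
    · subst h; simp
    · simp [Finsupp.single_eq_of_ne' h]
  have hdiv : ∀ j, (Finsupp.single i p + s) j / p = s j / p + if j = i then 1 else 0 := by
    intro j
    by_cases h : j = i
    · subst h; simp [Nat.add_div_left _ hp.out.pos]
    · simp [Finsupp.single_eq_of_ne h, h]
  have hz : (⟨_, pCentral_mem_center p hq S (b i)⟩ :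
      Subalgebra.center F (UniversalEnvelopingAlgebra F L))
        * pCentralMonomial p hq S b (fun i => s i / p)
      = pCentralMonomial p hq S b (fun j => (Finsupp.single i p + s) j / p) := by
    simp only [pCentralMonomial, hdiv, pow_add, Finset.prod_mul_distrib, pow_ite, pow_one, pow_zero,
      Finset.prod_ite_eq', Finset.mem_univ, if_true]
    rw [mul_comm]
  rw [mixedMonomial, mixedMonomial, ← mul_assoc, ← hz]
  simp only [hmod]
  rfl

/-- In the new basis the central element of `b i` acts exactly as multiplication by `X i ^ p`, not
merely in leading degree. -/
theorem pbwHom_pCentral_mixedMap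
    (hq : IsPMapping F p q) (S : Module.Dual F L) (b : Module.Basis (Fin n) F L)
    (i : Fin n) (v : MvPolynomial (Fin n) F) :
    pbwHom b (pCentral p q S (b i)) (mixedMap p hq S b v)
      = mixedMap p hq S b (MvPolynomial.monomial (Finsupp.single i p) 1 * v) := by
  have : pbwHom b (pCentral p q S (b i)) ∘ₗ mixedMap p hq S b = mixedMap p hq S b ∘ₗ
      LinearMap.mulLeft F (MvPolynomial.monomial (Finsupp.single i p) (1 : F)) := by
    refine (MvPolynomial.basisMonomials (Fin n) F).ext fun s => ?_
    rw [MvPolynomial.coe_basisMonomials, LinearMap.comp_apply, LinearMap.comp_apply,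
      LinearMap.mulLeft_apply, MvPolynomial.monomial_mul, one_mul, mixedMap_monomial,
      mixedMap_monomial, ← pCentral_mul_mixedMonomial, map_mul, Module.End.mul_apply]
  exact congrArg (fun f => f v) this

/-- The subspace generated by the images of the elements `pCentral (b i)`. -/
noncomputable def pCentralRange (q : L → L) (S : Module.Dual F L)
    (b : Module.Basis (Fin n) F L) : Submodule F (MvPolynomial (Fin n) F) :=
  ⨆ i, LinearMap.range (pbwHom b (pCentral p q S (b i)))

/-- In the new basis `pCentralRange` lies in the ideal generated by the `X i ^ p`, whose elements
have no monomial with all exponents below `p`. -/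
theorem coeff_eq_zero_of_mixedMap_mem
    (hq : IsPMapping F p q) (S : Module.Dual F L) (b : Module.Basis (Fin n) F L)
    {v : MvPolynomial (Fin n) F}
    (hv : mixedMap p hq S b v ∈ pCentralRange p q S b) {s : Fin n →₀ ℕ} (hs : ∀ i, s i < p) :
    v.coeff s = 0 := by
  have hle : pCentralRange p q S b
      ≤ (LinearMap.ker (MvPolynomial.lcoeff F s)).map (mixedMap p hq S b) := by
    refine iSup_le fun i => ?_
    rintro _ ⟨w, rfl⟩
    obtain ⟨w, rfl⟩ := (mixedMap_bijective p hq S b).2 w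
    rw [pbwHom_pCentral_mixedMap]
    refine Submodule.mem_map_of_mem ?_
    rw [LinearMap.mem_ker, MvPolynomial.lcoeff_apply, MvPolynomial.coeff_monomial_mul', if_neg]
    rw [Finsupp.single_le_iff]
    exact not_le.2 (hs i)
  obtain ⟨w, hw, hwv⟩ := hle hv
  rw [← (mixedMap_bijective p hq S b).1 hwv]
  exact hw

theorem pbwRep_mem_pCentralRange
    (hq : IsPMapping F p q) (S : Module.Dual F L) (b : Module.Basis (Fin n) F L) (x : L) :
    pCentralRange p q S b ≤ (pCentralRange p q S b).comap (pbwRep b x) := by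
  refine iSup_le fun i => ?_
  rintro _ ⟨w, rfl⟩
  refine Submodule.mem_iSup_of_mem i ⟨pbwRep b x w, ?_⟩
  have h := Subalgebra.mem_center_iff.1 (pCentral_mem_center p hq S (b i))
    (UniversalEnvelopingAlgebra.ι F x)
  have h' := congrArg (fun t => pbwHom b t w) h
  simp only [map_mul, pbwHom_ι, Module.End.mul_apply] at h'
  exact h'.symm

/-- The action of `L` on the quotient of the polynomial ring by `pCentralRange`. -/
noncomputable def pbwQuotientRep
    (hq : IsPMapping F p q) (S : Module.Dual F L) (b : Module.Basis (Fin n) F L) :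
    L →ₗ⁅F⁆ Module.End F (MvPolynomial (Fin n) F ⧸ pCentralRange p q S b) where
  toFun x := Submodule.mapQ _ _ (pbwRep b x) (pbwRep_mem_pCentralRange p hq S b x)
  map_add' x y := by
    ext v
    simp
  map_smul' c x := by
    ext v
    simp
  map_lie' {x y} := by
    refine Submodule.linearMap_qext _ (LinearMap.ext fun v => ?_)
    simp [LieRing.of_associative_ring_bracket]

theorem pbwQuotientRep_mk
    (hq : IsPMapping F p q) (S : Module.Dual F L) (b : Module.Basis (Fin n) F L)
    (x : L) (v : MvPolynomial (Fin n) F) :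
    pbwQuotientRep p hq S b x (Submodule.Quotient.mk v) = Submodule.Quotient.mk (pbwRep b x v) :=
  rfl

/-- For basis vectors this holds because the images of their central elements were divided out. By
Jacobson's formula the condition is linear in `x`, so it holds on all of `L`. -/
theorem pbwQuotientRep_character
    (hq : IsPMapping F p q) (S : Module.Dual F L) (b : Module.Basis (Fin n) F L)
    (x : L) : pbwQuotientRep p hq S b x ^ p
    = pbwQuotientRep p hq S b (q x) + algebraMap F _ (S x ^ p) := by
  have hb : ⊤ ≤ characterSubspace p hq S (pbwQuotientRep p hq S b) := by
    rw [← b.span_eq, Submodule.span_le]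
    rintro _ ⟨i, rfl⟩
    change pbwQuotientRep p hq S b (b i) ^ p
      = pbwQuotientRep p hq S b (q (b i)) + algebraMap F _ (S (b i) ^ p)
    refine Submodule.linearMap_qext _ (LinearMap.ext fun v => ?_)
    have hpow : ∀ m : ℕ, (pbwQuotientRep p hq S b (b i) ^ m) (Submodule.Quotient.mk v)
        = Submodule.Quotient.mk ((pbwRep b (b i) ^ m) v) := by
      intro m
      induction m with
      | zero => rfl
      | succ m ih =>
        rw [pow_succ', pow_succ', Module.End.mul_apply, ih, pbwQuotientRep_mk,
          Module.End.mul_apply]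
    rw [LinearMap.comp_apply, LinearMap.comp_apply, Submodule.mkQ_apply, hpow, LinearMap.add_apply,
      pbwQuotientRep_mk, Module.algebraMap_end_apply, ← Submodule.Quotient.mk_smul,
      ← Submodule.Quotient.mk_add, Submodule.Quotient.eq]
    refine Submodule.mem_iSup_of_mem i ⟨v, ?_⟩
    rw [pCentral, map_sub, map_sub, map_pow, pbwHom_ι, pbwHom_ι, AlgHom.commutes,
      LinearMap.sub_apply, LinearMap.sub_apply, Module.algebraMap_end_apply, sub_sub]
  exact hb (Submodule.mem_top (x := x))

/-- The linear independence part of the Poincaré–Birkhoff–Witt theorem for `u(L, S)`. -/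
theorem linearIndependent_ordMonomial
    (hq : IsPMapping F p q) (S : Module.Dual F L) (b : Module.Basis (Fin n) F L)
    : LinearIndependent F fun s : Fin n → Fin p =>
    ordMonomial (fun i => ReducedEnveloping.ι p q S (b i)) (fun i => (s i : ℕ)) := by
  let τ : ReducedEnveloping p q S →ₐ[F] _ :=
    ReducedEnveloping.lift (pbwQuotientRep p hq S b) (pbwQuotientRep_character p hq S b)
  -- Acting on the class of `1` detects independence: reduced monomials have all `p`-quotients zero,
  -- so they go to the classes of mixed monomials with exponents below `p`.
  let e : ReducedEnveloping p q S →ₗ[F] MvPolynomial (Fin n) F ⧸ pCentralRange p q S b :=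
    (LinearMap.applyₗ (R := F) (Submodule.Quotient.mk 1)) ∘ₗ τ.toLinearMap
  let toFinsupp : (Fin n → Fin p) → (Fin n →₀ ℕ) := fun s =>
    Finsupp.equivFunOnFinite.symm fun i => (s i : ℕ)
  have hinj : Function.Injective toFinsupp := fun s t h => by
    funext i
    exact Fin.ext (DFunLike.congr_fun h i)
  have he : ∀ s : Fin n → Fin p, e (ordMonomial (fun i => ReducedEnveloping.ι p q S (b i))
      (fun i => (s i : ℕ))) = Submodule.Quotient.mk
        (mixedMap p hq S b (MvPolynomial.monomial (toFinsupp s) 1)) := by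
    intro s
    have h1 : mixedMonomial p hq S b (toFinsupp s)
        = ordMonomial (fun i => UniversalEnvelopingAlgebra.ι F (b i)) (fun i => (s i : ℕ)) := by
      have hd : ∀ i, toFinsupp s i / p = 0 := fun i => Nat.div_eq_of_lt (s i).2
      have hm : ∀ i, toFinsupp s i % p = s i := fun i => Nat.mod_eq_of_lt (s i).2
      simp only [mixedMonomial, hd, hm, pCentralMonomial, pow_zero, Finset.prod_const_one,
        OneMemClass.coe_one, one_mul]
    rw [mixedMap_monomial, h1, map_ordMonomial (pbwHom b)]
    simp only [pbwHom_ι]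
    have h2 : e (ordMonomial (fun i => ReducedEnveloping.ι p q S (b i)) (fun i => (s i : ℕ)))
        = ordMonomial (fun i => pbwQuotientRep p hq S b (b i)) (fun i => (s i : ℕ))
          (Submodule.Quotient.mk 1) := by
      change τ (ordMonomial _ _) _ = _
      rw [map_ordMonomial]
      simp only [τ, ReducedEnveloping.lift_ι]
    rw [h2]
    exact (map_ordMonomial_apply (Submodule.mkQ _) (fun i v => rfl) _ _).symm
  refine LinearIndependent.of_comp e ?_
  rw [Fintype.linearIndependent_iff]
  intro c hc s
  simp only [Function.comp_apply, he] at hc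
  have h1 : mixedMap p hq S b (∑ t, c t • MvPolynomial.monomial (toFinsupp t) 1)
      ∈ pCentralRange p q S b := by
    rw [← Submodule.Quotient.mk_eq_zero, ← hc, map_sum]
    simp only [map_smul]
    exact map_sum (Submodule.mkQ _) _ _
  have h2 := coeff_eq_zero_of_mixedMap_mem p hq S b h1 (s := toFinsupp s) fun i => (s i).2
  rw [MvPolynomial.coeff_sum, Finset.sum_eq_single s] at h2
  · simpa using h2
  · intro t _ hts
    rw [MvPolynomial.coeff_smul, MvPolynomial.coeff_monomial, if_neg fun h => hts (hinj h),
      smul_zero]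
  · simp

end Independence

/-! ### Filtration of a representation by word length. -/

section WordFiltration

variable {F L V : Type*} [Field F] [LieRing L] [LieAlgebra F L] [AddCommGroup V] [Module F V]
  (ρ : L →ₗ⁅F⁆ Module.End F V) (M₀ : Submodule F V)

/-- The span of all `x₁ ⋯ xᵣ m` with `xᵢ ∈ L`, `m ∈ M₀` and `r < d`. -/
def wordFilt : ℕ → Submodule F V
  | 0 => ⊥
  | d + 1 => M₀ ⊔ wordFilt d ⊔ ⨆ x : L, (wordFilt d).map (ρ x)

variable {ρ M₀}

theorem le_wordFilt_succ (d : ℕ) : M₀ ≤ wordFilt ρ M₀ (d + 1) :=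
  le_sup_left.trans le_sup_left

theorem wordFilt_le_succ (d : ℕ) : wordFilt ρ M₀ d ≤ wordFilt ρ M₀ (d + 1) :=
  le_sup_right.trans le_sup_left

theorem wordFilt_mono : Monotone (wordFilt ρ M₀) :=
  monotone_nat_of_le_succ wordFilt_le_succ

theorem apply_mem_wordFilt (x : L) {d : ℕ} {v : V} (hv : v ∈ wordFilt ρ M₀ d) :
    ρ x v ∈ wordFilt ρ M₀ (d + 1) :=
  le_sup_right (a := M₀ ⊔ wordFilt ρ M₀ d)
    (Submodule.mem_iSup_of_mem x (Submodule.mem_map_of_mem hv))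

theorem wordFilt_succ_le {d : ℕ} {K : Submodule F V} (h₀ : M₀ ≤ K) (h₁ : wordFilt ρ M₀ d ≤ K)
    (h₂ : ∀ x, ∀ v ∈ wordFilt ρ M₀ d, ρ x v ∈ K) : wordFilt ρ M₀ (d + 1) ≤ K :=
  sup_le (sup_le h₀ h₁) (iSup_le fun x => Submodule.map_le_iff_le_comap.2 (h₂ x))

theorem iSup_wordFilt_stable (x : L) {v : V} (hv : v ∈ ⨆ d, wordFilt ρ M₀ d) :
    ρ x v ∈ ⨆ d, wordFilt ρ M₀ d := by
  obtain ⟨d, hd⟩ := (Submodule.mem_iSup_of_directed _ wordFilt_mono.directed_le).1 hv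
  exact Submodule.mem_iSup_of_mem (d + 1) (apply_mem_wordFilt x hd)

theorem map_lie_apply (x y : L) (v : V) : ρ ⁅x, y⁆ v = ρ x (ρ y v) - ρ y (ρ x v) := by
  rw [LieHom.map_lie, LieRing.of_associative_ring_bracket]
  rfl

/-- Moving `h` past a letter `x` leaves `[h, x]`, a single letter, so no word becomes longer. -/
theorem stable_wordFilt {H : Submodule F L} (hH : ∀ h ∈ H, ∀ m ∈ M₀, ρ h m ∈ M₀) (d : ℕ) :
    ∀ h ∈ H, ∀ v ∈ wordFilt ρ M₀ d, ρ h v ∈ wordFilt ρ M₀ d := by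
  induction d with
  | zero =>
    intro h _ v hv
    obtain rfl := (Submodule.mem_bot F).1 hv
    simp
  | succ d ih =>
    intro h hh
    refine wordFilt_succ_le (K := (wordFilt ρ M₀ (d + 1)).comap (ρ h)) ?_ ?_ ?_
    · exact fun m hm => le_wordFilt_succ d (hH h hh m hm)
    · exact fun v hv => wordFilt_le_succ d (ih h hh v hv)
    · intro x v hv
      have h1 := map_lie_apply (ρ := ρ) h x v
      rw [Submodule.mem_comap, ← sub_add_cancel (ρ h (ρ x v)) (ρ x (ρ h v)), ← h1]
      exact Submodule.add_mem _ (apply_mem_wordFilt _ hv) (apply_mem_wordFilt _ (ih h hh v hv))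

/-! ### Normal forms of words modulo shorter words. -/

section Words

variable {k : ℕ} (e : Fin k → L)

variable (ρ) in
/-- The operator `e l₁ ⋯ e lᵣ` for a word `l` in the indices. -/
def word (l : List (Fin k)) : Module.End F V := (l.map fun i => ρ (e i)).prod

theorem word_nil (m : V) : word ρ e [] m = m := rfl

theorem word_cons (i : Fin k) (l : List (Fin k)) (m : V) :
    word ρ e (i :: l) m = ρ (e i) (word ρ e l m) := by
  rw [word, List.map_cons, List.prod_cons, Module.End.mul_apply, word]

theorem word_append (l l' : List (Fin k)) (m : V) :
    word ρ e (l ++ l') m = word ρ e l (word ρ e l' m) := by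
  rw [word, List.map_append, List.prod_append, Module.End.mul_apply, word, word]

theorem word_mem (l : List (Fin k)) {m : V} (hm : m ∈ M₀) :
    word ρ e l m ∈ wordFilt ρ M₀ (l.length + 1) := by
  induction l with
  | nil => exact le_wordFilt_succ _ hm
  | cons i l ih => rw [word_cons]; exact apply_mem_wordFilt _ ih

/-- Exchanging two neighbouring letters costs their commutator, which is one letter instead of two.
-/
theorem word_perm {l l' : List (Fin k)} (h : l.Perm l') {m : V} (hm : m ∈ M₀) :
    word ρ e l m - word ρ e l' m ∈ wordFilt ρ M₀ l.length := by
  induction h with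
  | nil => rw [sub_self]; exact Submodule.zero_mem _
  | cons i _ ih => rw [word_cons, word_cons, ← map_sub]; exact apply_mem_wordFilt _ ih
  | swap i j l =>
    rw [word_cons, word_cons, word_cons, word_cons, ← map_lie_apply]
    exact apply_mem_wordFilt _ (word_mem e l hm)
  | trans h _ ih ih' =>
    rw [← h.length_eq] at ih'
    have := Submodule.add_mem _ ih ih'
    rwa [sub_add_sub_cancel] at this

/-- Letters from `H` are absorbed without adding length, so only the `e i` are needed. -/
theorem wordFilt_succ_le_words {H : Submodule F L} (hH : ∀ h ∈ H, ∀ m ∈ M₀, ρ h m ∈ M₀)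
    (hspan : H ⊔ Submodule.span F (Set.range e) = ⊤) (d : ℕ) :
    wordFilt ρ M₀ (d + 1) ≤ wordFilt ρ M₀ d ⊔
      Submodule.span F {v | ∃ l : List (Fin k), l.length = d ∧ ∃ m ∈ M₀, v = word ρ e l m} := by
  induction d with
  | zero =>
    refine wordFilt_succ_le ?_ le_sup_left ?_
    · exact fun m hm => le_sup_right (a := wordFilt ρ M₀ 0)
        (Submodule.subset_span ⟨[], rfl, m, hm, rfl⟩)
    · intro x v hv
      obtain rfl := (Submodule.mem_bot F).1 hv
      simp
  | succ d ih =>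
    set K := wordFilt ρ M₀ (d + 1) ⊔ Submodule.span F
      {v | ∃ l : List (Fin k), l.length = d + 1 ∧ ∃ m ∈ M₀, v = word ρ e l m} with hK
    have hle : wordFilt ρ M₀ (d + 1) ≤ K := le_sup_left
    refine wordFilt_succ_le ((le_wordFilt_succ d).trans hle) hle ?_
    intro x v hv
    have hx : ⊤ ≤ K.comap ((ρ : L →ₗ[F] Module.End F V).flip v) := by
      rw [← hspan]
      refine sup_le (fun h hh => hle (stable_wordFilt hH _ h hh v hv)) (Submodule.span_le.2 ?_)
      rintro _ ⟨i, rfl⟩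
      have : wordFilt ρ M₀ (d + 1) ≤ K.comap (ρ (e i)) := by
        refine ih.trans (sup_le (fun w hw => hle (apply_mem_wordFilt _ hw))
          (Submodule.span_le.2 ?_))
        rintro _ ⟨l, rfl, m, hm, rfl⟩
        exact le_sup_right (a := wordFilt ρ M₀ (l.length + 1))
          (Submodule.subset_span ⟨i :: l, rfl, m, hm, (word_cons e i l m).symm⟩)
      exact this hv
    exact hx (Submodule.mem_top (x := x))

variable {p : ℕ} [hp : Fact p.Prime] {q : L → L} {S : Module.Dual F L}

/-- Collect `p` copies of the letter in front and use the `p`-character: they become one letter plus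
a scalar, which is shorter because `p ≥ 2`. -/
theorem word_mem_of_le_count (hρ : ∀ x, ρ x ^ p = ρ (q x) + algebraMap F _ (S x ^ p))
    {l : List (Fin k)} {i : Fin k} (hi : p ≤ l.count i) {m : V} (hm : m ∈ M₀) :
    word ρ e l m ∈ wordFilt ρ M₀ l.length := by
  have h2 := hp.out.two_le
  obtain ⟨l', hl'⟩ := (List.replicate_sublist_iff.2 hi).exists_perm_append
  have hlen : l.length = p + l'.length := by rw [hl'.length_eq]; simp
  have h1 := word_perm (ρ := ρ) e hl' hm
  have h3 : word ρ e (List.replicate p i ++ l') m ∈ wordFilt ρ M₀ l.length := by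
    rw [word_append, word, List.map_replicate, List.prod_replicate, hρ, LinearMap.add_apply,
      Module.algebraMap_end_apply, hlen]
    exact Submodule.add_mem _ (wordFilt_mono (by omega) (apply_mem_wordFilt _ (word_mem e l' hm)))
      (Submodule.smul_mem _ _ (wordFilt_mono (by omega) (word_mem e l' hm)))
  have := Submodule.add_mem _ h1 h3
  rwa [sub_add_cancel] at this

theorem wordFilt_succ_le_reduced (hρ : ∀ x, ρ x ^ p = ρ (q x) + algebraMap F _ (S x ^ p))
    {H : Submodule F L} (hH : ∀ h ∈ H, ∀ m ∈ M₀, ρ h m ∈ M₀)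
    (hspan : H ⊔ Submodule.span F (Set.range e) = ⊤) (d : ℕ) :
    wordFilt ρ M₀ (d + 1) ≤ wordFilt ρ M₀ d ⊔ Submodule.span F
      {v | ∃ l : List (Fin k), l.length = d ∧ (∀ i, l.count i < p) ∧
        ∃ m ∈ M₀, v = word ρ e l m} := by
  refine (wordFilt_succ_le_words e hH hspan d).trans (sup_le le_sup_left (Submodule.span_le.2 ?_))
  rintro _ ⟨l, rfl, m, hm, rfl⟩
  by_cases h : ∀ i, l.count i < p
  · exact le_sup_right (a := wordFilt ρ M₀ l.length) (Submodule.subset_span ⟨l, rfl, h, m, hm, rfl⟩)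
  · push Not at h
    obtain ⟨i, hi⟩ := h
    exact Submodule.mem_sup_left (word_mem_of_le_count e hρ hi hm)

theorem exists_perm_ordMonomial (l : List (Fin k)) : ∃ l' : List (Fin k), l.Perm l' ∧
    word ρ e l' = ordMonomial (fun i => ρ (e i)) fun i => l.count i := by
  refine ⟨(List.ofFn fun i => List.replicate (l.count i) i).flatten, ?_, ?_⟩
  · rw [List.perm_iff_count]
    intro j
    rw [List.count_flatten, List.map_ofFn, List.sum_ofFn]
    simp [List.count_replicate]
  · rw [word, List.map_flatten, List.prod_flatten, List.map_map, List.map_ofFn, ordMonomial]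
    congr 2
    funext i
    simp

/-- The spanning part of the Poincaré–Birkhoff–Witt theorem, relative to a subspace `H` of `L`. -/
theorem iSup_wordFilt_le_ordMonomial
    (hρ : ∀ x, ρ x ^ p = ρ (q x) + algebraMap F _ (S x ^ p))
    {H : Submodule F L} (hH : ∀ h ∈ H, ∀ m ∈ M₀, ρ h m ∈ M₀)
    (hspan : H ⊔ Submodule.span F (Set.range e) = ⊤) :
    ⨆ d, wordFilt ρ M₀ d ≤ Submodule.span F {v | ∃ s : Fin k → Fin p, ∃ m ∈ M₀,
      v = ordMonomial (fun i => ρ (e i)) (fun i => (s i : ℕ)) m} := by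
  refine iSup_le fun d => ?_
  induction d with
  | zero => exact bot_le
  | succ d ih =>
    refine (wordFilt_succ_le_reduced e hρ hH hspan d).trans (sup_le ih (Submodule.span_le.2 ?_))
    rintro _ ⟨l, rfl, hl, m, hm, rfl⟩
    obtain ⟨l', hll', hl'⟩ := exists_perm_ordMonomial (ρ := ρ) e l
    have h1 := ih (word_perm (ρ := ρ) e hll' hm)
    have h2 := Submodule.add_mem _ h1 (Submodule.subset_span
      ⟨fun i => ⟨l.count i, hl i⟩, m, hm, congrArg (fun T => T m) hl'⟩)
    rwa [sub_add_cancel] at h2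

end Words

/-! ### Lowering operators from the ideal `I`. -/

section Lowering

variable {I : LieIdeal F L} (lam : Module.Dual F I)

variable (ρ) in
/-- The operator `y - λ(y)`. -/
def shifted (y : I) : Module.End F V := ρ (y : L) - algebraMap F _ (lam y)

theorem shifted_apply (y : I) (v : V) : shifted ρ lam y v = ρ (y : L) v - lam y • v := rfl

theorem shifted_apply_apply (y : I) (x : L) (v : V) : shifted ρ lam y (ρ x v)
    = ρ x (shifted ρ lam y v) - shifted ρ lam ⁅x, y⁆ v - lam ⁅x, y⁆ • v := by
  have h := map_lie_apply (ρ := ρ) x (y : L) v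
  rw [shifted_apply, shifted_apply, shifted_apply, map_sub, map_smul]
  rw [LieSubmodule.coe_bracket, h]
  abel

variable {lam}

/-- Commuting `y - λ(y)` past a letter `x` leaves an operator of the same kind, for `[x, y] ∈ I`,
and the scalar `λ([x, y])` in place of the letter. On `M₀` all these operators vanish. -/
theorem shifted_mem
    (hlam : ∀ y : I, ∀ m ∈ M₀, ρ (y : L) m = lam y • m)
    (d : ℕ) : ∀ (y : I) (v : V), v ∈ wordFilt ρ M₀ (d + 1) →
    shifted ρ lam y v ∈ wordFilt ρ M₀ d := by
  have hm : ∀ (y : I) (m : V), m ∈ M₀ → shifted ρ lam y m = 0 := fun y m hm => by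
    rw [shifted_apply, hlam y m hm, sub_self]
  induction d with
  | zero =>
    intro y
    refine wordFilt_succ_le (K := (wordFilt ρ M₀ 0).comap (shifted ρ lam y)) ?_ ?_ ?_
    · intro m h
      rw [Submodule.mem_comap, hm y m h]
      exact Submodule.zero_mem _
    · exact bot_le
    · intro x v hv
      obtain rfl := (Submodule.mem_bot F).1 hv
      simp
  | succ d ih =>
    intro y
    refine wordFilt_succ_le (K := (wordFilt ρ M₀ (d + 1)).comap (shifted ρ lam y)) ?_ ?_ ?_
    · intro m h
      rw [Submodule.mem_comap, hm y m h]
      exact Submodule.zero_mem _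
    · exact fun v hv => wordFilt_le_succ d (ih y v hv)
    · intro x v hv
      rw [Submodule.mem_comap, shifted_apply_apply]
      exact Submodule.sub_mem _ (Submodule.sub_mem _ (apply_mem_wordFilt x (ih y v hv))
        (wordFilt_le_succ d (ih _ v hv))) (Submodule.smul_mem _ _ hv)

variable {k : ℕ} (e : Fin k → L) (y : Fin k → I)

variable (ρ lam) in
/-- The operator `e i (y i - λ(y i))`, which multiplies words by the number of letters `i`, up to
shorter words. -/
def counting (i : Fin k) : Module.End F V := ρ (e i) * shifted ρ lam (y i)

theorem counting_mem
    (hlam : ∀ y : I, ∀ m ∈ M₀, ρ (y : L) m = lam y • m)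
    (i : Fin k) (d : ℕ) {v : V} (hv : v ∈ wordFilt ρ M₀ d) :
    counting ρ lam e y i v ∈ wordFilt ρ M₀ d := by
  rcases d with _ | d
  · obtain rfl := (Submodule.mem_bot F).1 hv
    simp
  · exact apply_mem_wordFilt _ (shifted_mem hlam d _ v hv)

theorem counting_apply_sub_mem
    (hlam : ∀ y : I, ∀ m ∈ M₀, ρ (y : L) m = lam y • m)
    (hy : ∀ i j, lam ⁅e j, y i⁆ = if i = j then -1 else 0)
    (i j : Fin k) (d : ℕ) {v : V} (hv : v ∈ wordFilt ρ M₀ (d + 1)) :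
    counting ρ lam e y i (ρ (e j) v) - (ρ (e j) (counting ρ lam e y i v)
      + (if i = j then (1 : F) else 0) • ρ (e j) v) ∈ wordFilt ρ M₀ (d + 1) := by
  -- The error terms first lose a letter through a shifted operator and then gain one, so they stay
  -- below the length of `e j v`.
  have h1 : counting ρ lam e y i (ρ (e j) v) - (ρ (e j) (counting ρ lam e y i v)
      + (if i = j then (1 : F) else 0) • ρ (e j) v)
      = ρ ⁅e i, e j⁆ (shifted ρ lam (y i) v) - ρ (e i) (shifted ρ lam ⁅e j, y i⁆ v) := by
    rw [map_lie_apply, counting, Module.End.mul_apply, Module.End.mul_apply, shifted_apply_apply,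
      map_sub, map_sub, map_smul, hy]
    by_cases h : i = j
    · subst h; simp
    · simp [h]; abel
  rw [h1]
  exact Submodule.sub_mem _ (apply_mem_wordFilt _ (shifted_mem hlam d _ v hv))
    (apply_mem_wordFilt _ (shifted_mem hlam d _ v hv))

/-- Each letter `i` contributes `1` to the eigenvalue and every other letter `0`, as for an Euler
operator. -/
theorem counting_word_sub_mem
    (hlam : ∀ y : I, ∀ m ∈ M₀, ρ (y : L) m = lam y • m)
    (hy : ∀ i j, lam ⁅e j, y i⁆ = if i = j then -1 else 0)
    (i : Fin k) (l : List (Fin k)) {m : V} (hm : m ∈ M₀) :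
    counting ρ lam e y i (word ρ e l m) - (l.count i : F) • word ρ e l m
      ∈ wordFilt ρ M₀ l.length := by
  induction l with
  | nil =>
    rw [word_nil, counting, Module.End.mul_apply, shifted_apply, hlam (y i) m hm]
    simp
  | cons j l ih =>
    have h1 := counting_apply_sub_mem e y hlam hy i j _ (word_mem (ρ := ρ) e l hm)
    have h2 := Submodule.add_mem _ h1 (apply_mem_wordFilt (e j) ih)
    rw [word_cons, List.length_cons]
    convert h2 using 1
    rw [List.count_cons, map_sub, map_smul]
    by_cases h : i = j
    · subst h; simp [add_smul]; abel
    · simp [h, Ne.symm h]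

variable (p : ℕ)

theorem counting_pow_word_sub_mem
    (hlam : ∀ y : I, ∀ m ∈ M₀, ρ (y : L) m = lam y • m)
    (hy : ∀ i j, lam ⁅e j, y i⁆ = if i = j then -1 else 0)
    (i : Fin k) (l : List (Fin k)) {m : V} (hm : m ∈ M₀) (r : ℕ) :
    (counting ρ lam e y i ^ r) (word ρ e l m) - (l.count i : F) ^ r • word ρ e l m
      ∈ wordFilt ρ M₀ l.length := by
  induction r with
  | zero => simp
  | succ r ih =>
    have h1 := Submodule.add_mem _ (counting_mem e y hlam i _ ih)
      (Submodule.smul_mem _ ((l.count i : F) ^ r) (counting_word_sub_mem e y hlam hy i l hm))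
    rw [map_sub, map_smul, smul_sub, smul_smul, sub_add_sub_cancel, ← pow_succ,
      ← Module.End.mul_apply, ← pow_succ'] at h1
    exact h1

variable (ρ lam) in
/-- The operator `∏ (1 - counting i ^ (p - 1))` over the indices in a list. -/
def countingProj (li : List (Fin k)) : Module.End F V :=
  (li.map fun i => 1 - counting ρ lam e y i ^ (p - 1)).prod

theorem countingProj_cons (i : Fin k) (li : List (Fin k)) (v : V) :
    countingProj ρ lam e y p (i :: li) v = countingProj ρ lam e y p li v
      - (counting ρ lam e y i ^ (p - 1)) (countingProj ρ lam e y p li v) := by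
  rw [countingProj, List.map_cons, List.prod_cons, Module.End.mul_apply, LinearMap.sub_apply]
  rfl

theorem pow_apply_mem {K : Submodule F V} {T : Module.End F V} (h : ∀ v ∈ K, T v ∈ K) (r : ℕ)
    {v : V} (hv : v ∈ K) : (T ^ r) v ∈ K := by
  induction r with
  | zero => exact hv
  | succ r ih => rw [pow_succ', Module.End.mul_apply]; exact h _ ih

theorem countingProj_mem {K : Submodule F V} (hK : ∀ i, ∀ v ∈ K, counting ρ lam e y i v ∈ K)
    (li : List (Fin k)) {v : V} (hv : v ∈ K) : countingProj ρ lam e y p li v ∈ K := by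
  induction li with
  | nil => exact hv
  | cons i li ih =>
    rw [countingProj_cons]
    exact Submodule.sub_mem _ ih (pow_apply_mem (hK i) _ ih)

theorem countingProj_word_sub_mem
    (hlam : ∀ y : I, ∀ m ∈ M₀, ρ (y : L) m = lam y • m)
    (hy : ∀ i j, lam ⁅e j, y i⁆ = if i = j then -1 else 0)
    (l : List (Fin k)) {m : V} (hm : m ∈ M₀) (li : List (Fin k)) :
    countingProj ρ lam e y p li (word ρ e l m)
      - (li.map fun i => 1 - (l.count i : F) ^ (p - 1)).prod • word ρ e l m
      ∈ wordFilt ρ M₀ l.length := by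
  induction li with
  | nil => simp [countingProj]
  | cons i li ih =>
    have h1 := pow_apply_mem (fun v hv => counting_mem e y hlam i l.length hv) (p - 1) ih
    have h2 := Submodule.smul_mem _ (li.map fun i => 1 - (l.count i : F) ^ (p - 1)).prod
      (counting_pow_word_sub_mem e y hlam hy i l hm (p - 1))
    have h3 := Submodule.sub_mem _ ih (Submodule.add_mem _ h1 h2)
    rw [countingProj_cons, List.map_cons, List.prod_cons]
    convert h3 using 1
    rw [map_sub, map_smul, smul_sub, smul_smul, sub_mul, one_mul, sub_smul,
      mul_comm ((l.count i : F) ^ (p - 1))]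
    abel

/-- Since `p - 1 ≥ 1`, every nontrivial term of the product begins with a shifted operator applied
to `w`, which lands in `W₀`; only the term `1` survives. -/
theorem countingProj_sub_mem [hp : Fact p.Prime] {W₀ : Submodule F V}
    (hW₀ : ∀ x : L, ∀ v ∈ W₀, ρ x v ∈ W₀) {w : V}
    (hw : ∀ z : I, shifted ρ lam z w ∈ W₀) (li : List (Fin k)) :
    countingProj ρ lam e y p li w - w ∈ W₀ := by
  have hs : ∀ i, ∀ v ∈ W₀, counting ρ lam e y i v ∈ W₀ := fun i v hv =>
    hW₀ _ _ (Submodule.sub_mem _ (hW₀ _ _ hv) (Submodule.smul_mem _ _ hv))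
  have h2 := hp.out.two_le
  induction li with
  | nil => simp [countingProj]
  | cons i li ih =>
    obtain ⟨r, hr⟩ : ∃ r, p - 1 = r + 1 := ⟨p - 2, by omega⟩
    have h3 : (counting ρ lam e y i ^ (p - 1)) w ∈ W₀ := by
      rw [hr, pow_succ, Module.End.mul_apply]
      exact pow_apply_mem (hs i) r (hW₀ _ _ (hw _))
    have h4 := Submodule.sub_mem _ (Submodule.sub_mem _ ih (pow_apply_mem (hs i) (p - 1) ih)) h3
    rw [countingProj_cons]
    convert h4 using 1
    rw [map_sub]
    abel

/-- A vector on which the ideal `I` acts through `λ` modulo an `L`-stable subspace lies in the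
bottom layer modulo that subspace. -/
theorem mem_sup_of_shifted_mem
    (hlam : ∀ y : I, ∀ m ∈ M₀, ρ (y : L) m = lam y • m)
    (hy : ∀ i j, lam ⁅e j, y i⁆ = if i = j then -1 else 0)
    [hp : Fact p.Prime] [CharP F p] {q : L → L} {S : Module.Dual F L}
    (hρ : ∀ x, ρ x ^ p = ρ (q x) + algebraMap F _ (S x ^ p))
    {H : Submodule F L} (hH : ∀ h ∈ H, ∀ m ∈ M₀, ρ h m ∈ M₀)
    (hspan : H ⊔ Submodule.span F (Set.range e) = ⊤)
    {W₀ : Submodule F V} (hW₀ : ∀ x : L, ∀ v ∈ W₀, ρ x v ∈ W₀) (d : ℕ) :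
    ∀ w ∈ wordFilt ρ M₀ d, (∀ z : I, shifted ρ lam z w ∈ W₀) → w ∈ M₀ ⊔ W₀ := by
  induction d with
  | zero =>
    intro w hw _
    obtain rfl := (Submodule.mem_bot F).1 hw
    exact Submodule.zero_mem _
  | succ d ih =>
    intro w hw hz
    -- The empty word is not killed by the product, but `wordFilt ρ M₀ 1` already lies in `M₀`.
    rcases Nat.eq_zero_or_pos d with rfl | hd
    · refine (wordFilt_succ_le (K := M₀ ⊔ W₀) le_sup_left bot_le fun x v hv => ?_) hw
      obtain rfl := (Submodule.mem_bot F).1 hv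
      simp
    set T := countingProj ρ lam e y p (List.finRange k)
    have h1 : T w ∈ wordFilt ρ M₀ d := by
      have : wordFilt ρ M₀ (d + 1) ≤ (wordFilt ρ M₀ d).comap T := by
        refine (wordFilt_succ_le_reduced e hρ hH hspan d).trans (sup_le ?_ (Submodule.span_le.2 ?_))
        · exact fun v hv => countingProj_mem e y p
            (fun i v hv => counting_mem e y hlam i d hv) _ hv
        · rintro _ ⟨l, rfl, hl, m, hm, rfl⟩
          obtain ⟨i, hi⟩ : ∃ i, i ∈ l := List.exists_mem_of_length_pos hd
          -- A letter that occurs has a count strictly between `0` and `p`, so Fermat's little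
          -- theorem makes its factor vanish.
          have h0 : ((List.finRange k).map fun i => 1 - (l.count i : F) ^ (p - 1)).prod = 0 := by
            refine List.prod_eq_zero (List.mem_map.2 ⟨i, List.mem_finRange i, ?_⟩)
            rw [sub_eq_zero]
            symm
            have hc : l.count i ≠ 0 := (List.count_pos_iff.2 hi).ne'
            have := ZMod.pow_card_sub_one_eq_one (p := p) (a := (l.count i : ZMod p)) (by
              rw [Ne, ZMod.natCast_eq_zero_iff]
              exact fun h => absurd (Nat.le_of_dvd (Nat.pos_of_ne_zero hc) h) (not_le.2 (hl i)))
            have h' := congrArg (ZMod.castHom (dvd_refl p) F) this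
            simpa using h'
          have h2 := countingProj_word_sub_mem e y p hlam hy l hm (List.finRange k)
          rwa [h0, zero_smul, sub_zero] at h2
      exact this hw
    have h2 := countingProj_sub_mem e y p hW₀ hz (List.finRange k)
    -- The hypothesis on `w` passes to `T w`, which is congruent to `w` modulo the stable subspace
    -- `W₀`.
    have h3 : T w ∈ M₀ ⊔ W₀ := ih _ h1 fun z => by
      have h4 : shifted ρ lam z (T w - w) ∈ W₀ :=
        Submodule.sub_mem _ (hW₀ _ _ h2) (Submodule.smul_mem _ _ h2)
      rw [map_sub] at h4
      have := Submodule.add_mem _ h4 (hz z)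
      rwa [sub_add_cancel] at this
    have h5 := Submodule.sub_mem _ h3 (le_sup_right (a := M₀) h2)
    rwa [sub_sub_cancel] at h5

end Lowering

end WordFiltration

/-! ### Generation and spanning of `u(L, S)`. -/

section ReducedGenerators

variable {F L : Type*} [Field F] [LieRing L] [LieAlgebra F L] {p : ℕ} {q : L → L}
  {S : Module.Dual F L}

theorem ReducedEnveloping.hom_ext {A : Type*} [Ring A] [Algebra F A]
    {f g : ReducedEnveloping p q S →ₐ[F] A}
    (h : ∀ x, f (ReducedEnveloping.ι p q S x) = g (ReducedEnveloping.ι p q S x)) : f = g := by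
  refine RingQuot.ringQuot_ext' F f g ?_
  exact UniversalEnvelopingAlgebra.hom_ext F (LieHom.ext h)

theorem ReducedEnveloping.adjoin_range_ι :
    Algebra.adjoin F (Set.range (ReducedEnveloping.ι p q S)) = ⊤ := by
  set C := Algebra.adjoin F (Set.range (ReducedEnveloping.ι p q S))
  let f : L →ₗ⁅F⁆ C :=
    { toFun := fun x => ⟨ReducedEnveloping.ι p q S x, Algebra.subset_adjoin ⟨x, rfl⟩⟩
      map_add' := fun x y => Subtype.ext (map_add _ x y)
      map_smul' := fun c x => Subtype.ext (map_smul _ c x)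
      map_lie' := fun {x y} => Subtype.ext (LieHom.map_lie _ x y) }
  have hf : ∀ x, f x ^ p = f (q x) + algebraMap F C (S x ^ p) := fun x =>
    Subtype.ext (ReducedEnveloping.ι_pow p q S x)
  have hid : C.val.comp (ReducedEnveloping.lift f hf) = AlgHom.id F _ :=
    ReducedEnveloping.hom_ext fun x => by
      rw [AlgHom.comp_apply, ReducedEnveloping.lift_ι]
      rfl
  refine eq_top_iff.2 fun t _ => ?_
  have h := congrArg (fun φ => φ t) hid
  rw [AlgHom.id_apply] at h
  rw [← h]
  exact (ReducedEnveloping.lift f hf t).2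

theorem ReducedEnveloping.map_mem_of_stable {V : Type*} [AddCommGroup V] [Module F V]
    (φ : ReducedEnveloping p q S →ₐ[F] Module.End F V) {K : Submodule F V}
    (hK : ∀ x, ∀ v ∈ K, φ (ReducedEnveloping.ι p q S x) v ∈ K) (a : ReducedEnveloping p q S) :
    ∀ v ∈ K, φ a v ∈ K := by
  have ha : a ∈ Algebra.adjoin F (Set.range (ReducedEnveloping.ι p q S)) := by
    rw [ReducedEnveloping.adjoin_range_ι]
    exact Algebra.mem_top
  induction ha using Algebra.adjoin_induction with
  | mem a ha =>
    obtain ⟨x, rfl⟩ := ha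
    exact hK x
  | algebraMap c =>
    intro v hv
    rw [AlgHom.commutes, Module.algebraMap_end_apply]
    exact K.smul_mem c hv
  | add a b _ _ ha hb =>
    intro v hv
    rw [map_add, LinearMap.add_apply]
    exact K.add_mem (ha v hv) (hb v hv)
  | mul a b _ _ ha hb =>
    intro v hv
    rw [map_mul, Module.End.mul_apply]
    exact ha _ (hb v hv)

/-- The spanning part of the Poincaré–Birkhoff–Witt theorem for `u(L, S)`. -/
theorem span_ordMonomial [hp : Fact p.Prime] {n : ℕ} {b : Fin n → L}
    (hb : Submodule.span F (Set.range b) = ⊤) :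
    Submodule.span F (Set.range fun s : Fin n → Fin p =>
      ordMonomial (fun i => ReducedEnveloping.ι p q S (b i)) (fun i => (s i : ℕ))) = ⊤ := by
  let m : ReducedEnveloping p q S →ₐ[F] Module.End F (ReducedEnveloping p q S) := Algebra.lmul F _
  let ρ : L →ₗ⁅F⁆ Module.End F (ReducedEnveloping p q S) :=
    (m : _ →ₗ⁅F⁆ _).comp (ReducedEnveloping.ι p q S)
  have hρ : ∀ x, ρ x ^ p = ρ (q x) + algebraMap F _ (S x ^ p) := by
    intro x
    change m (ReducedEnveloping.ι p q S x) ^ p = m (ReducedEnveloping.ι p q S (q x)) + _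
    rw [← map_pow, ReducedEnveloping.ι_pow, map_add, AlgHom.commutes]
  have h1 := iSup_wordFilt_le_ordMonomial (M₀ := Submodule.span F {1}) b hρ (H := ⊥) (by
    intro h hh v hv
    obtain rfl := (Submodule.mem_bot F).1 hh
    simp) (by rw [hb, bot_sup_eq])
  refine eq_top_iff.2 fun a _ => ?_
  have h2 := ReducedEnveloping.map_mem_of_stable m
    (K := ⨆ d, wordFilt ρ (Submodule.span F {1}) d)
    (fun x v hv => iSup_wordFilt_stable (ρ := ρ) x hv) a 1
    (Submodule.mem_iSup_of_mem 1 (le_wordFilt_succ 0 (Submodule.mem_span_singleton_self 1)))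
  rw [show m a 1 = a from mul_one a] at h2
  refine Submodule.span_le.2 ?_ (h1 h2)
  rintro _ ⟨s, v, hv, rfl⟩
  obtain ⟨c, rfl⟩ := Submodule.mem_span_singleton.1 hv
  rw [map_smul]
  refine Submodule.smul_mem _ _ (Submodule.subset_span ⟨s, ?_⟩)
  have h3 := map_ordMonomial m (fun i => ReducedEnveloping.ι p q S (b i)) (fun i => (s i : ℕ))
  exact ((congrArg (fun T => T 1) h3).symm.trans (mul_one _)).symm

end ReducedGenerators

/-! ### Freeness of `u(L, S)` over `u(H, S)`. -/

section Freeness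

theorem ordMonomial_append {A : Type*} [Monoid A] {k l : ℕ} (f : Fin k → A) (g : Fin l → A)
    (s : Fin k → ℕ) (t : Fin l → ℕ) :
    ordMonomial (Fin.append f g) (Fin.append s t) = ordMonomial f s * ordMonomial g t := by
  have : (fun i => Fin.append f g i ^ Fin.append s t i)
      = Fin.append (fun i => f i ^ s i) (fun i => g i ^ t i) := by
    funext i
    refine Fin.addCases (fun i => ?_) (fun i => ?_) i <;> simp
  rw [ordMonomial, this, List.ofFn_fin_append, List.prod_append, ordMonomial, ordMonomial]

theorem exists_adapted_basis {F V : Type*} [Field F] [AddCommGroup V] [Module F V]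
    [FiniteDimensional F V] (H : Submodule F V) :
    ∃ (k l : ℕ) (e : Fin k → V) (h : Module.Basis (Fin l) F H) (b : Module.Basis (Fin (k + l)) F V),
      ∀ i, b i = Fin.append e (fun j => (h j : V)) i := by
  obtain ⟨C, hC⟩ := H.exists_isCompl
  let c := Module.finBasis F C
  let h := Module.finBasis F H
  refine ⟨_, _, fun i => (c i : V), h, ((c.prod h).map
    (Submodule.prodEquivOfIsCompl C H hC.symm)).reindex finSumFinEquiv, fun i => ?_⟩
  refine Fin.addCases (fun i => ?_) (fun i => ?_) i
  · simp
  · simp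

variable {F L : Type*} [Field F] [LieRing L] [LieAlgebra F L] (p : ℕ)
  {q : L → L} (S : Module.Dual F L) (H : LieSubalgebra F L) (hH : IsPSubalgebra q H)

/-- The map `⊕ u(H, S) → u(L, S)` given by the ordered monomials in a family `e` of elements. -/
noncomputable def monomialSum {k : ℕ} (e : Fin k → L) :
    ((Fin k → Fin p) → ReducedEnveloping p (restrictPMapping q H hH) (restrictForm S H))
      →ₗ[F] ReducedEnveloping p q S where
  toFun g := ∑ a, ordMonomial (fun i => ReducedEnveloping.ι p q S (e i)) (fun i => (a i : ℕ))
    * ReducedEnveloping.incl p q S H hH (g a)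
  map_add' g g' := by simp [mul_add, Finset.sum_add_distrib]
  map_smul' c g := by simp [Finset.smul_sum]

theorem monomialSum_apply {k : ℕ} (e : Fin k → L)
    (g : (Fin k → Fin p) → ReducedEnveloping p (restrictPMapping q H hH) (restrictForm S H)) :
    monomialSum p S H hH e g
      = ∑ a, ordMonomial (fun i => ReducedEnveloping.ι p q S (e i)) (fun i => (a i : ℕ))
        * ReducedEnveloping.incl p q S H hH (g a) := rfl

theorem monomialSum_single {k : ℕ} (e : Fin k → L) (a : Fin k → Fin p)
    (z : ReducedEnveloping p (restrictPMapping q H hH) (restrictForm S H)) :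
    monomialSum p S H hH e (Pi.single a z)
      = ordMonomial (fun i => ReducedEnveloping.ι p q S (e i)) (fun i => (a i : ℕ))
        * ReducedEnveloping.incl p q S H hH z := by
  rw [monomialSum_apply, Finset.sum_eq_single a]
  · rw [Pi.single_eq_same]
  · intro a' _ h
    rw [Pi.single_eq_of_ne h, map_zero, mul_zero]
  · simp

theorem monomialSum_mul {k : ℕ} (e : Fin k → L)
    (g : (Fin k → Fin p) → ReducedEnveloping p (restrictPMapping q H hH) (restrictForm S H))
    (z : ReducedEnveloping p (restrictPMapping q H hH) (restrictForm S H)) :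
    monomialSum p S H hH e (fun a => g a * z)
      = monomialSum p S H hH e g * ReducedEnveloping.incl p q S H hH z := by
  simp only [monomialSum_apply, Finset.sum_mul, map_mul, mul_assoc]

variable {k l : ℕ} {e : Fin k → L} {h : Module.Basis (Fin l) F H}
  {b : Module.Basis (Fin (k + l)) F L}

theorem ordMonomial_adapted (hb : ∀ i, b i = Fin.append e (fun j => (h j : L)) i)
    (a : Fin k → Fin p) (t : Fin l → Fin p) :
    ordMonomial (fun i => ReducedEnveloping.ι p q S (b i))
        (fun i => ((Fin.append a t : Fin (k + l) → Fin p) i : ℕ))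
      = ordMonomial (fun i => ReducedEnveloping.ι p q S (e i)) (fun i => (a i : ℕ))
        * ReducedEnveloping.incl p q S H hH
          (ordMonomial (fun j => ReducedEnveloping.ι p _ _ (h j)) (fun j => (t j : ℕ))) := by
  rw [map_ordMonomial, ← ordMonomial_append]
  congr 1
  · funext i
    rw [hb]
    refine Fin.addCases (fun i => ?_) (fun i => ?_) i
    · simp
    · simp [ReducedEnveloping.incl_ι]
  · funext i
    refine Fin.addCases (fun i => ?_) (fun i => ?_) i <;> simp

/-- In a basis with the complement listed before `H`, each ordered monomial factors as a monomial in
`e` times one from `H`. Both halves of Poincaré–Birkhoff–Witt then give freeness over `u(H, S)`. -/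
theorem monomialSum_bijective [hp : Fact p.Prime] [CharP F p] (hq : IsPMapping F p q)
    (hb : ∀ i, b i = Fin.append e (fun j => (h j : L)) i) :
    Function.Bijective (monomialSum p S H hH e) := by
  constructor
  · refine (injective_iff_map_eq_zero _).2 fun g hg => ?_
    have hex : ∀ a, ∃ c : (Fin l → Fin p) → F, ∑ t, c t • ordMonomial
        (fun j => ReducedEnveloping.ι p (restrictPMapping q H hH) (restrictForm S H) (h j))
        (fun j => (t j : ℕ)) = g a := fun a => by
      rw [← Submodule.mem_span_range_iff_exists_fun, span_ordMonomial h.span_eq]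
      exact Submodule.mem_top
    choose c hc using hex
    have hli := (linearIndependent_ordMonomial p hq S b).comp
      (fun at' : (Fin k → Fin p) × (Fin l → Fin p) => (Fin.append at'.1 at'.2 : _ → Fin p))
      (fun at1 at2 h12 => by
        have h12' := congrArg (Fin.appendEquiv k l).symm h12
        simpa [Fin.appendEquiv] using h12')
    rw [Fintype.linearIndependent_iff] at hli
    have h0 := hli (fun at' => c at'.1 at'.2) (by
      rw [Fintype.sum_prod_type, ← hg, monomialSum_apply]
      refine Finset.sum_congr rfl fun a _ => ?_
      rw [← hc a, map_sum, Finset.mul_sum]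
      refine Finset.sum_congr rfl fun t _ => ?_
      rw [map_smul, mul_smul_comm, ← ordMonomial_adapted p S H hH hb]
      rfl)
    funext a
    rw [← hc a]
    exact Finset.sum_eq_zero fun t _ => by rw [h0 (a, t), zero_smul]
  · rw [← LinearMap.range_eq_top, eq_top_iff, ← span_ordMonomial (p := p) (S := S) b.span_eq,
      Submodule.span_le]
    rintro _ ⟨s, rfl⟩
    obtain ⟨a, t, rfl⟩ : ∃ (a : Fin k → Fin p) (t : Fin l → Fin p), s = Fin.append a t :=
      ⟨_, _, (Fin.append_castAdd_natAdd (f := s)).symm⟩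
    exact ⟨_, (monomialSum_single p S H hH e a _).trans (ordMonomial_adapted p S H hH hb a t).symm⟩

/-- `u(H, S)` is a direct summand of `u(L, S)` as a right module. -/
theorem exists_retraction [hp : Fact p.Prime] [CharP F p] [FiniteDimensional F L]
    (hq : IsPMapping F p q) :
    ∃ π : ReducedEnveloping p q S
        →ₗ[F] ReducedEnveloping p (restrictPMapping q H hH) (restrictForm S H),
      π 1 = 1 ∧ ∀ a z, π (a * ReducedEnveloping.incl p q S H hH z) = π a * z := by
  obtain ⟨k, l, e, h, b, hb⟩ := exists_adapted_basis H.toSubmodule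
  let Φ := LinearEquiv.ofBijective _ (monomialSum_bijective p S H hH (h := h) hq hb)
  let a₀ : Fin k → Fin p := fun _ => ⟨0, hp.out.pos⟩
  -- The retraction is the coordinate at the empty monomial, the basis element `1`.
  refine ⟨LinearMap.proj a₀ ∘ₗ Φ.symm.toLinearMap, ?_, fun a z => ?_⟩
  · have : Φ.symm 1 = Pi.single a₀ 1 := by
      rw [LinearEquiv.symm_apply_eq]
      change 1 = monomialSum p S H hH e _
      rw [monomialSum_single]
      simp [a₀, ordMonomial]
    change Φ.symm 1 a₀ = 1
    rw [this, Pi.single_eq_same]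
  · obtain ⟨g, rfl⟩ := Φ.surjective a
    have : Φ.symm (Φ g * ReducedEnveloping.incl p q S H hH z) = fun a => g a * z := by
      rw [LinearEquiv.symm_apply_eq]
      exact (monomialSum_mul p S H hH e g z).symm
    change Φ.symm _ a₀ = Φ.symm (Φ g) a₀ * z
    rw [this, LinearEquiv.symm_apply_apply]

end Freeness

/-! ### The bottom layer of an induced module. -/

section InducedModule

variable {F L : Type*} [Field F] [LieRing L] [LieAlgebra F L] (p : ℕ)
  {q : L → L} (S : Module.Dual F L) (H : LieSubalgebra F L) (hH : IsPSubalgebra q H)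
  (M : Type*) [AddCommGroup M] [Module F M] [LieRingModule H M] [LieModule F H M]
  (hM : HasCharacter p (restrictPMapping q H hH) (restrictForm S H) M)

namespace Ind

/-- The map `m ↦ 1 ⊗ m`. -/
noncomputable def unit : M →ₗ[F] Ind p q S H hH M hM where
  toFun m := tmul p q S H hH M hM 1 m
  map_add' _ _ := congrArg Submodule.Quotient.mk (TensorProduct.tmul_add _ _ _)
  map_smul' _ _ := congrArg Submodule.Quotient.mk (TensorProduct.tmul_smul _ _ _)

theorem unit_apply (m : M) : unit p S H hH M hM m = tmul p q S H hH M hM 1 m := rfl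

theorem smul_unit (a : ReducedEnveloping p q S) (m : M) :
    a • unit p S H hH M hM m = tmul p q S H hH M hM a m := by
  rw [unit_apply, smul_tmul, mul_one]

theorem tmul_incl (z : ReducedEnveloping p (restrictPMapping q H hH) (restrictForm S H)) (m : M) :
    tmul p q S H hH M hM (ReducedEnveloping.incl p q S H hH z) m
      = unit p S H hH M hM (ReducedEnveloping.toEnd M hM z m) := by
  refine (Submodule.Quotient.eq _).2 (Submodule.subset_span ⟨1, z, m, ?_⟩)
  rw [one_mul]

theorem lie_unit (x : H) (m : M) :
    ⁅(x : L), unit p S H hH M hM m⁆ = unit p S H hH M hM ⁅x, m⁆ := by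
  rw [lie_def, smul_unit, ← ReducedEnveloping.incl_ι p q S H hH, tmul_incl,
    ReducedEnveloping.toEnd_ι]

theorem unit_injective [hp : Fact p.Prime] [CharP F p] [FiniteDimensional F L]
    (hq : IsPMapping F p q) :
    Function.Injective (unit p S H hH M hM) := by
  obtain ⟨π, hπ1, hπ⟩ := exists_retraction p S H hH hq
  refine (injective_iff_map_eq_zero _).2 fun m hm => ?_
  let T : ReducedEnveloping p q S ⊗[F] M →ₗ[F] M :=
    TensorProduct.lift ((ReducedEnveloping.toEnd M hM).toLinearMap ∘ₗ π)
  -- The map `a ⊗ m ↦ π(a) m` need not be linear over `u(L, S)`, while the relations span a left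
  -- submodule. Quantifying over all multiples `b • t` lets the span induction go through.
  have hT : ∀ t ∈ balancedRel (ReducedEnveloping.incl p q S H hH) (ReducedEnveloping.toEnd M hM),
      ∀ b : ReducedEnveloping p q S, T (b • t) = 0 := by
    intro t ht
    induction ht using Submodule.span_induction with
    | mem t ht =>
      obtain ⟨c, z, m, rfl⟩ := ht
      intro b
      rw [smul_sub, TensorProduct.smul_tmul', TensorProduct.smul_tmul', map_sub,
        TensorProduct.lift.tmul, TensorProduct.lift.tmul, smul_eq_mul, smul_eq_mul, ← mul_assoc]
      simp [hπ]
    | zero => simp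
    | add t t' _ _ h h' => intro b; rw [smul_add, map_add, h, h', add_zero]
    | smul a t _ h => intro b; rw [smul_smul]; exact h _
  have h1 := hT _ ((Submodule.Quotient.mk_eq_zero _).1 hm) 1
  rw [one_smul, TensorProduct.lift.tmul] at h1
  simpa [hπ1] using h1

variable {M hM}

theorem eq_top_of_unit_mem {K : Submodule F (Ind p q S H hH M hM)}
    (hu : ∀ m, unit p S H hH M hM m ∈ K) (hK : ∀ x : L, ∀ t ∈ K, ⁅x, t⁆ ∈ K) : K = ⊤ := by
  have hs : ∀ (a : ReducedEnveloping p q S), ∀ t ∈ K, a • t ∈ K := fun a =>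
    ReducedEnveloping.map_mem_of_stable (Algebra.lsmul F F (Ind p q S H hH M hM)) hK a
  refine eq_top_iff.2 fun t _ => ?_
  obtain ⟨t, rfl⟩ := Submodule.Quotient.mk_surjective _ t
  induction t using TensorProduct.induction_on with
  | zero => exact K.zero_mem
  | add t t' h h' => exact K.add_mem (h trivial) (h' trivial)
  | tmul a m =>
    have := hs a _ (hu m)
    rwa [smul_unit] at this

theorem toEnd_pow_character (x : L) : LieModule.toEnd F L (Ind p q S H hH M hM) x ^ p
    = LieModule.toEnd F L (Ind p q S H hH M hM) (q x) + algebraMap F _ (S x ^ p) := by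
  have h : ∀ x, LieModule.toEnd F L (Ind p q S H hH M hM) x
      = Algebra.lsmul F F (Ind p q S H hH M hM) (ReducedEnveloping.ι p q S x) := fun _ => rfl
  rw [h, h, ← map_pow, ReducedEnveloping.ι_pow, map_add, AlgHom.commutes]

variable (N : LieSubmodule F H M)

theorem coe_toEnd_lieSubmodule
    (z : ReducedEnveloping p (restrictPMapping q H hH) (restrictForm S H)) (n : N) :
    ((ReducedEnveloping.toEnd N (hM.lieSubmodule N) z n : N) : M)
      = ReducedEnveloping.toEnd M hM z n := by
  have hz : z ∈ Algebra.adjoin F (Set.range (ReducedEnveloping.ι p _ _)) := by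
    rw [ReducedEnveloping.adjoin_range_ι]
    exact Algebra.mem_top
  induction hz using Algebra.adjoin_induction generalizing n with
  | mem a ha =>
    obtain ⟨x, rfl⟩ := ha
    rw [ReducedEnveloping.toEnd_ι, ReducedEnveloping.toEnd_ι, LieSubmodule.coe_bracket]
  | algebraMap c => simp [Module.algebraMap_end_apply]
  | add a b _ _ ha hb => simp [ha, hb]
  | mul a b _ _ ha hb => simp [ha, hb]

variable (hM) in
/-- The map `Ind N → Ind M` for a submodule `N` of `M`. -/
noncomputable def mapSubmodule :
    Ind p q S H hH N (hM.lieSubmodule N) →ₗ[ReducedEnveloping p q S] Ind p q S H hH M hM :=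
  Submodule.mapQ (balancedRel (ReducedEnveloping.incl p q S H hH)
      (ReducedEnveloping.toEnd N (hM.lieSubmodule N)))
    (balancedRel (ReducedEnveloping.incl p q S H hH) (ReducedEnveloping.toEnd M hM))
    (TensorProduct.AlgebraTensorModule.map LinearMap.id N.toSubmodule.subtype) (by
      refine Submodule.span_le.2 ?_
      rintro _ ⟨b, z, n, rfl⟩
      refine Submodule.subset_span ⟨b, z, n, ?_⟩
      rw [map_sub, TensorProduct.AlgebraTensorModule.map_tmul,
        TensorProduct.AlgebraTensorModule.map_tmul, ← coe_toEnd_lieSubmodule]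
      rfl)

end Ind

end InducedModule

/-! ### Comparison of submodules by their bottom layers. -/

section BottomLayer

variable {F L : Type*} [Field F] [LieRing L] [LieAlgebra F L]

/-- A basis of a complement of `L^λ`, and the dual elements of `I` with respect to `λ([·, ·])`. -/
theorem exists_dual_family [FiniteDimensional F L] (I : LieIdeal F L) (lam : Module.Dual F I) :
    ∃ (k : ℕ) (e : Fin k → L) (y : Fin k → I),
      (lambdaSubalgebra I lam).toSubmodule ⊔ Submodule.span F (Set.range e) = ⊤ ∧
      ∀ i j, lam ⁅e j, y i⁆ = if i = j then -1 else 0 := by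
  obtain ⟨C, hC⟩ := (lambdaSubalgebra I lam).toSubmodule.exists_isCompl
  let c := Module.finBasis F C
  let T : I →ₗ[F] (Fin (Module.finrank F C) → F) :=
    LinearMap.pi fun j => lam ∘ₗ (LieModule.toEnd F L I (c j : L))
  have hT : ∀ y j, T y j = lam ⁅(c j : L), y⁆ := fun _ _ => rfl
  -- A functional vanishing on the range is given by coefficients of an element of the complement
  -- that pairs to zero with all of `I`. That element lies in `L^λ` as well, hence is zero.
  have hsurj : LinearMap.range T = ⊤ := by
    by_contra hne
    obtain ⟨f, hf0, hf⟩ := Submodule.exists_le_ker_of_lt_top _ (lt_top_iff_ne_top.2 hne)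
    refine hf0 ?_
    have hx : (∑ j, f (Pi.single j 1) • c j : C) = 0 := by
      have h1 : ((∑ j, f (Pi.single j 1) • c j : C) : L) ∈ lambdaSubalgebra I lam := by
        intro y
        have h2 : f (T y) = 0 := hf (LinearMap.mem_range_self T y)
        rw [LinearMap.pi_apply_eq_sum_univ f (T y)] at h2
        rw [AddSubmonoidClass.coe_finsetSum, sum_lie, map_sum, ← h2]
        refine Finset.sum_congr rfl fun j _ => ?_
        rw [Submodule.coe_smul, smul_lie, map_smul, hT, smul_eq_mul, smul_eq_mul, mul_comm]
        congr 2
        funext i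
        simp [Pi.single_apply, eq_comm]
      have h3 := Submodule.disjoint_def.1 hC.disjoint _ h1 (Submodule.coe_mem _)
      exact Subtype.ext h3
    have h4 := Fintype.linearIndependent_iff.1 c.linearIndependent _ hx
    refine LinearMap.pi_ext' fun j => LinearMap.ext_ring ?_
    simpa using h4 j
  -- The sign compensates the `-λ([x, y])` that arises when `y` moves past `x`, so that letters are
  -- counted positively.
  have hy : ∀ i, ∃ y : I, T y = - Pi.single i 1 := fun i => by
    rw [← LinearMap.mem_range, hsurj]
    exact Submodule.mem_top
  choose y hy using hy
  refine ⟨_, fun j => (c j : L), y, ?_, fun i j => ?_⟩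
  · have : Submodule.span F (Set.range fun j => (c j : L)) = C := by
      have h1 := congrArg (Submodule.map C.subtype) c.span_eq
      rw [Submodule.map_span, ← Set.range_comp, Submodule.map_top, Submodule.range_subtype] at h1
      exact h1
    rw [this, hC.sup_eq_top]
  · rw [← hT, hy]
    by_cases h : i = j
    · subst h; simp
    · simp [h, Ne.symm h]

variable [FiniteDimensional F L] {p : ℕ} [hp : Fact p.Prime] [CharP F p] {q : L → L}
  {hq : IsPMapping F p q} {I : LieIdeal F L} {lam : Module.Dual F I} {S : Module.Dual F L}
  {M : Type*} [AddCommGroup M] [Module F M] [LieRingModule (lambdaSubalgebra I lam) M]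
  [LieModule F (lambdaSubalgebra I lam) M]
  {hM : HasCharacter p
      (restrictPMapping q (lambdaSubalgebra I lam) (isPSubalgebra_lambdaSubalgebra hq I lam))
      (restrictForm S (lambdaSubalgebra I lam)) M}

/-- A submodule of `Ind_{L^λ}^L(M, S)` lies in another one if its bottom layer does. -/
theorem IndLambda.le_of_bottom_le (hlam : ∀ x y : I, lam ⁅x, y⁆ = 0)
    (hI : ∀ (x : lambdaSubalgebra I lam) (hx : (x : L) ∈ I) (m : M), ⁅x, m⁆ = lam ⟨x, hx⟩ • m)
    {W W' : LieSubmodule F L (IndLambda p hq S I lam M hM)}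
    (h : ∀ m : M, (IndLambda.tmul 1 m : IndLambda p hq S I lam M hM) ∈ W →
      (IndLambda.tmul 1 m : IndLambda p hq S I lam M hM) ∈ W') : W ≤ W' := by
  obtain ⟨k, e, y, hspan, hy⟩ := exists_dual_family I lam
  set ρ := LieModule.toEnd F L (IndLambda p hq S I lam M hM) with hρ
  set u := Ind.unit p S (lambdaSubalgebra I lam) (isPSubalgebra_lambdaSubalgebra hq I lam) M hM
    with hu
  set M₀ := LinearMap.range u with hM₀
  have hH : ∀ x ∈ (lambdaSubalgebra I lam).toSubmodule, ∀ m ∈ M₀, ρ x m ∈ M₀ := by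
    rintro x hx _ ⟨m, rfl⟩
    exact ⟨_, (Ind.lie_unit p S _ _ M hM ⟨x, hx⟩ m).symm⟩
  have hIm : ∀ z : I, ∀ m ∈ M₀, ρ (z : L) m = lam z • m := by
    rintro z _ ⟨m, rfl⟩
    -- The condition `λ([I, I]) = 0` is what puts `I` inside `L^λ`.
    have hz : (z : L) ∈ lambdaSubalgebra I lam := fun w => hlam z w
    have h1 := Ind.lie_unit p S _ (isPSubalgebra_lambdaSubalgebra hq I lam) M hM ⟨z, hz⟩ m
    rw [hI ⟨z, hz⟩ z.2 m, map_smul] at h1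
    exact h1
  have htop : ⨆ d, wordFilt ρ M₀ d = ⊤ :=
    Ind.eq_top_of_unit_mem p S _ _
      (fun m => Submodule.mem_iSup_of_mem 1 (le_wordFilt_succ 0 (LinearMap.mem_range_self u m)))
      (fun x t ht => iSup_wordFilt_stable x ht)
  have key : ∀ d, ∀ w ∈ wordFilt ρ M₀ d, w ∈ W → w ∈ W' := by
    intro d
    induction d with
    | zero =>
      intro w hw _
      obtain rfl := (Submodule.mem_bot F).1 hw
      exact W'.zero_mem
    | succ d ih =>
      intro w hw hwW
      -- The shifted vector stays in `W` and is shorter, so induction puts it in `W'`. Using `W ⊓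
      -- W'` as the stable subspace, rather than `W'`, keeps the resulting bottom component of `w`
      -- in `W`.
      have hsh : ∀ z : I, shifted ρ lam z w ∈ (W ⊓ W').toSubmodule := fun z => by
        have h1 : shifted ρ lam z w ∈ W := W.sub_mem (W.lie_mem hwW) (W.smul_mem _ hwW)
        exact ⟨h1, ih _ (shifted_mem hIm d z w hw) h1⟩
      have h2 := mem_sup_of_shifted_mem e y p hIm hy (Ind.toEnd_pow_character p S _ _) hH hspan
        (W₀ := (W ⊓ W').toSubmodule) (fun x v hv => (W ⊓ W').lie_mem hv) (d + 1) w hw hsh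
      obtain ⟨_, ⟨m, rfl⟩, w₀, hw₀, rfl⟩ := Submodule.mem_sup.1 h2
      have h3 : u m ∈ W := by
        have := W.sub_mem hwW hw₀.1
        rwa [add_sub_cancel_right] at this
      exact W'.add_mem (h m h3) hw₀.2
  intro w hw
  have hw' : w ∈ ⨆ d, wordFilt ρ M₀ d := htop ▸ Submodule.mem_top
  obtain ⟨d, hd⟩ := (Submodule.mem_iSup_of_directed _ wordFilt_mono.directed_le).1 hw'
  exact key d w hd hw

end BottomLayer

end ModularLie

/-! ### The classification of submodules by their bottom layers. -/

theorem mainTheorem2 {F L M : Type*} [Field F] (p : ℕ) [Fact p.Prime] [CharP F p]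
    [LieRing L] [LieAlgebra F L] [FiniteDimensional F L]
    (q : L → L) (hq : IsPMapping F p q)
    (I : LieIdeal F L) (lam : Module.Dual F I) (hlam : ∀ x y : I, lam ⁅x, y⁆ = 0)
    (S : Module.Dual F L)
    [AddCommGroup M] [Module F M] [FiniteDimensional F M]
    [LieRingModule (lambdaSubalgebra I lam) M] [LieModule F (lambdaSubalgebra I lam) M]
    (hM : HasCharacter p
      (restrictPMapping q (lambdaSubalgebra I lam) (isPSubalgebra_lambdaSubalgebra hq I lam))
      (restrictForm S (lambdaSubalgebra I lam)) M)
    (hI : ∀ (x : lambdaSubalgebra I lam) (hx : (x : L) ∈ I) (m : M), ⁅x, m⁆ = lam ⟨x, hx⟩ • m)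
    (W : LieSubmodule F L (IndLambda p hq S I lam M hM)) :
    (∃ N : LieSubmodule F (lambdaSubalgebra I lam) M,
      ((W : Set (IndLambda p hq S I lam M hM)) ∩
          Set.range (fun m : M => (IndLambda.tmul 1 m : IndLambda p hq S I lam M hM))
        = (fun m : M => (IndLambda.tmul 1 m : IndLambda p hq S I lam M hM)) '' (N : Set M)) ∧
      ∃ φ : IndLambda p hq S I lam N (hM.lieSubmodule N) ≃ₗ⁅F,L⁆ W,
        ∀ (a : ReducedEnveloping p q S) (n : N),
          (φ (IndLambda.tmul a n) : IndLambda p hq S I lam M hM) = IndLambda.tmul a (n : M)) ∧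
    ∀ W' : LieSubmodule F L (IndLambda p hq S I lam M hM),
      (W' : Set (IndLambda p hq S I lam M hM)) ∩
          Set.range (fun m : M => (IndLambda.tmul 1 m : IndLambda p hq S I lam M hM))
        = (W : Set (IndLambda p hq S I lam M hM)) ∩
          Set.range (fun m : M => (IndLambda.tmul 1 m : IndLambda p hq S I lam M hM)) →
      W' = W := by
  have hH := isPSubalgebra_lambdaSubalgebra hq I lam
  refine ⟨?_, fun W' h => ?_⟩
  · let u := Ind.unit p S (lambdaSubalgebra I lam) hH M hM
    let N : LieSubmodule F (lambdaSubalgebra I lam) M :=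
      { W.toSubmodule.comap u with
        lie_mem := fun {x m} hm => by
          change u ⁅x, m⁆ ∈ W
          rw [← Ind.lie_unit]
          exact W.lie_mem hm }
    let ψ := Ind.mapSubmodule p S (lambdaSubalgebra I lam) hH hM N
    let ψ' : IndLambda p hq S I lam N (hM.lieSubmodule N) →ₗ⁅F,L⁆ IndLambda p hq S I lam M hM :=
      { ψ.restrictScalars F with
        map_lie' := fun {x t} => ψ.map_smul _ _ }
    -- Injectivity comes from the comparison principle in `Ind N`: if `1 ⊗ n` maps to zero, then `n
    -- = 0` by injectivity of `m ↦ 1 ⊗ m` on `M`.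
    have hker : ψ'.ker ≤ ⊥ := by
      refine IndLambda.le_of_bottom_le hlam (fun x hx n => Subtype.ext (hI x hx n))
        fun n hn => ?_
      have h1 : u n = 0 := hn
      have h2 : n = 0 := Subtype.ext (Ind.unit_injective p S _ hH M hM hq
        (h1.trans (map_zero u).symm))
      rw [h2]
      exact (map_zero (Ind.unit p S (lambdaSubalgebra I lam) hH N (hM.lieSubmodule N)))
    -- The image lies in `W` because the elements `1 ⊗ n` generate `Ind N`. The reverse inclusion is
    -- the comparison principle in `Ind M`, since every `1 ⊗ m` in `W` has `m ∈ N`.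
    have hrange : ψ'.range = W := by
      refine le_antisymm ?_ (IndLambda.le_of_bottom_le hlam hI fun m hm =>
        ⟨IndLambda.tmul 1 (⟨m, hm⟩ : N), rfl⟩)
      have htop := Ind.eq_top_of_unit_mem p S (lambdaSubalgebra I lam) hH
        (hM := hM.lieSubmodule N) (K := W.toSubmodule.comap (ψ' : _ →ₗ[F] _))
        (fun n => n.2) (fun x t ht => by
          change ψ' ⁅x, t⁆ ∈ W
          rw [LieModuleHom.map_lie]
          exact W.lie_mem ht)
      rintro _ ⟨t, rfl⟩
      have ht : t ∈ W.toSubmodule.comap (ψ' : _ →ₗ[F] IndLambda p hq S I lam M hM) :=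
        htop ▸ Submodule.mem_top
      exact ht
    refine ⟨N, ?_, ?_⟩
    · ext t
      constructor
      · rintro ⟨ht, m, rfl⟩
        exact ⟨m, ht, rfl⟩
      · rintro ⟨m, hm, rfl⟩
        exact ⟨hm, m, rfl⟩
    · have hmem : ∀ t, ψ' t ∈ W := fun t => hrange ▸ ⟨t, rfl⟩
      let χ : IndLambda p hq S I lam N (hM.lieSubmodule N) →ₗ⁅F,L⁆ W :=
        { toFun := fun t => ⟨ψ' t, hmem t⟩
          map_add' := fun s t => Subtype.ext (map_add ψ' s t)
          map_smul' := fun c t => Subtype.ext (map_smul ψ' c t)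
          map_lie' := fun {x t} => Subtype.ext (ψ'.map_lie x t) }
      have hbij : Function.Bijective χ := by
        constructor
        · refine (injective_iff_map_eq_zero χ).2 fun t ht => ?_
          exact hker (congrArg Subtype.val ht)
        · rintro ⟨w, hw⟩
          rw [← hrange] at hw
          obtain ⟨t, rfl⟩ := hw
          exact ⟨t, rfl⟩
      let E := Equiv.ofBijective χ hbij
      exact ⟨{ χ with invFun := E.symm, left_inv := E.left_inv, right_inv := E.right_inv },
        fun a n => rfl⟩
  · have hmem : ∀ m : M, (IndLambda.tmul 1 m : IndLambda p hq S I lam M hM) ∈ W' ↔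
        (IndLambda.tmul 1 m : IndLambda p hq S I lam M hM) ∈ W := fun m => by
      have := Set.ext_iff.1 h (IndLambda.tmul 1 m)
      simpa using this
    exact le_antisymm (IndLambda.le_of_bottom_le hlam hI fun m => (hmem m).1)
      (IndLambda.le_of_bottom_le hlam hI fun m => (hmem m).2)
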